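/- **Setting.** Let $n\ge 1$ and let $k\ge 2$ be even. There are $k$ sites; site $i$ holds a block $b_i\in\{0,1\}^n$. The distribution $\psi_n$ of $(B,D,M)$ is as follows. Choose independently and uniformly $D_1,\dots,D_n\in[k]$, bits $A_1,\dots,A_n$, a special coordinate $M\in[n]$ and bits $U,V$; put $D=(D_1,\dots,D_n)$. In each coordinate $\ell\ne M$ site $D_\ell$ has the bit $A_\ell$ and all other sites have $0$. In the coordinate $M$ each of the first $k/2$ sites has the bit $U$ and each of the remaining $k/2$ sites has the bit $V$. Let $B$ be the resulting input of the $k$ sites. The type of the instance is $S=(X,Y)\in\{00,01,10,11\}$, where $X=1$ iff the inputs of the first $k/2$ sites in coordinate $M$ are all $1$, and $Y=1$ iff the inputs of the other $k/2$ sites in coordinate $M$ are all $1$. In the $k$-GUESS problem the $k$ sites, on input $B$, run a randomized protocol in the blackboard model (every written bit is seen by everybody; sites have independent private random strings, independent of the input, and all parties may also share an independent public random string $R$). Let $\Pi$ be the transcript of the messages that they write. A predictor, who writes nothing, then guesses $S$ by a deterministic function of $\Pi$, of $(D,M)$ and, if there is public randomness, of $R$. The protocol succeeds if the guess equals $S$;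 the success probability is taken over $\psi_n$ and all the randomness of the protocol. The conditional information cost of the protocol is the conditional mutual information $I(B;\Pi\mid D,M)$ (in bits), with $(B,D,M)\sim\psi_n$; if there is public randomness, it is conditioned on as well, so that the cost is $I(B;\Pi\mid D,M,R)=I(B;(R,\Pi)\mid D,M)$. **Theorem 4.2.** For every $\delta>0$ there is a constant $c>0$, depending only on $\delta$, such that for all $n\ge 1$, all even $k\ge 2$ and every randomized protocol for $k$-GUESS with success probability at least $\frac14+\delta$ on $\psi_n$, $$I(B;\Pi\mid D,M)\;\ge\; c\cdot\frac nk .$$ -/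

import Mathlib

open MeasureTheory

namespace KGuess

universe u w

/-! ### Shannon entropy and mutual information (base 2)

These are used for random variables that take finitely many values. -/

section Information

variable {Ω : Type*} {α β γ : Type*} [MeasurableSpace Ω]

/-- Shannon entropy `H(X)`, in bits. -/
noncomputable def entropy (μ : Measure Ω) (X : Ω → α) : ℝ :=
  (∑' a, Real.negMulLog (μ.real (X ⁻¹' {a}))) / Real.log 2

/-- Conditional entropy `H(X | Y) = H(X, Y) - H(Y)`. -/
noncomputable def condEntropy (μ : Measure Ω) (X : Ω → α) (Y : Ω → β) : ℝ :=
  entropy μ (fun ω => (X ω, Y ω)) - entropy μ Y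

/-- Conditional mutual information `I(X ; Y | Z) = H(X | Z) - H(X | Y, Z)`. -/
noncomputable def condMutualInfo (μ : Measure Ω) (X : Ω → α) (Y : Ω → β) (Z : Ω → γ) : ℝ :=
  condEntropy μ X Z - condEntropy μ X (fun ω => (Y ω, Z ω))

end Information

/-! ### Randomized protocols in the blackboard model -/

/-- A randomized `k`-party number-in-hand blackboard protocol, in which every site holds an input
of type `X`.  There is a public random string (type `Pub`, visible to everybody) and every site `i`
has a private random string (type `Priv i`); all of these are independent, with arbitrary laws.
The public string and the current content of the blackboard determine which site writes the next
bit, or that the communication is over (`none`).  The bit which a site writes depends on the public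
string, its own private string, its own input and the content of the blackboard.
At most `cost` bits are written. -/
structure Protocol (k : ℕ) (X : Type w) where
  /-- public random strings -/
  Pub : Type u
  [pubSpace : MeasurableSpace Pub]
  pubLaw : Measure Pub
  [pubProb : IsProbabilityMeasure pubLaw]
  /-- private random strings of the sites -/
  Priv : Fin k → Type u
  [privSpace : ∀ i, MeasurableSpace (Priv i)]
  privLaw : ∀ i, Measure (Priv i)
  [privProb : ∀ i, IsProbabilityMeasure (privLaw i)]
  /-- maximal number of bits written on the blackboard -/
  cost : ℕ
  /-- the site that writes next -/
  next : Pub → List Bool → Option (Fin k)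
  /-- the bit that it writes -/
  bit : ∀ i, Pub → Priv i → X → List Bool → Bool
  measurable_next : ∀ board o, MeasurableSet {r | next r board = o}
  measurable_bit : ∀ i x board, Measurable (fun p : Pub × Priv i => bit i p.1 p.2 x board)

attribute [instance] Protocol.pubSpace Protocol.pubProb Protocol.privSpace Protocol.privProb

namespace Protocol

variable {k : ℕ} {X : Type w} (P : Protocol.{u, w} k X)

/-- One step of the protocol: the next site, if any, appends its bit to the blackboard. -/
def step (r : P.Pub) (ρ : ∀ i, P.Priv i) (x : Fin k → X) (board : List Bool) : List Bool :=
  match P.next r board with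
  | none => board
  | some i => board ++ [P.bit i r (ρ i) (x i) board]

/-- The transcript: the final content of the blackboard, for the public string `r`, the private
strings `ρ` and the inputs `x`. -/
def transcript (r : P.Pub) (ρ : ∀ i, P.Priv i) (x : Fin k → X) : List Bool :=
  (P.step r ρ x)^[P.cost] []

end Protocol

/-! ### The input distribution `ψ_n` -/

/-- The independent uniform choices from which an input is constructed: the special sites
`D_1, …, D_n`, the special coordinate `M`, the bits that the special sites set, and the two bits
that replace the inputs of the first and of the second `k/2` sites in the special coordinate. -/
abbrev Sample (n k : ℕ) : Type :=
  (Fin n → Fin k) × Fin n × (Fin n → Bool) × Bool × Bool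

namespace Sample

variable {n k : ℕ}

/-- the special site of each coordinate -/
def D (s : Sample n k) : Fin n → Fin k := s.1

/-- the special coordinate -/
def M (s : Sample n k) : Fin n := s.2.1

/-- the bit that the special site of each coordinate sets -/
def A (s : Sample n k) : Fin n → Bool := s.2.2.1

/-- the replacing bit for the first `k/2` sites -/
def U (s : Sample n k) : Bool := s.2.2.2.1

/-- the replacing bit for the second `k/2` sites -/
def V (s : Sample n k) : Bool := s.2.2.2.2

/-- The input `B`: `s.B i ℓ` is the bit of site `i` in coordinate `ℓ`. -/
def B (s : Sample n k) : Fin k → Fin n → Bool := fun i ℓ =>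
  if ℓ = s.M then (if (i : ℕ) < k / 2 then s.U else s.V)
  else (if i = s.D ℓ then s.A ℓ else false)

/-- The input of the predictor. -/
def Z (s : Sample n k) : (Fin n → Fin k) × Fin n := (s.D, s.M)

/-- The type `(X, Y)` of the instance: `X = 1` iff the inputs of the first `k/2` sites in the
special coordinate are all `1`, and `Y = 1` iff those of the second `k/2` sites are. -/
def S (s : Sample n k) : Bool × Bool :=
  (decide (∀ i : Fin k, (i : ℕ) < k / 2 → s.B i s.M = true),
   decide (∀ i : Fin k, k / 2 ≤ (i : ℕ) → s.B i s.M = true))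

end Sample

/-- The law of the random choices behind `ψ_n`; `ψ_n` is the law of `(B, (D, M))` under it. -/
noncomputable def psi (n k : ℕ) : Measure (Sample n k) :=
  ProbabilityTheory.uniformOn Set.univ

/-! ### Success probability and information cost -/

namespace Protocol

variable {n k : ℕ} (P : Protocol.{u, 0} k (Fin n → Bool))

/-- The law of the input together with the private strings of the sites. -/
noncomputable def law : Measure (Sample n k × ∀ i, P.Priv i) :=
  (psi n k).prod (Measure.pi P.privLaw)

/-- The success probability on `ψ_n` when the predictor outputs `g r t z` on seeing the public
string `r`, the transcript `t` and its input `z = (D, M)`. -/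
noncomputable def successProb
    (g : P.Pub → List Bool → (Fin n → Fin k) × Fin n → Bool × Bool) : ℝ :=
  (P.pubLaw.prod P.law).real
    {p | g p.1 (P.transcript p.1 p.2.2 p.2.1.B) p.2.1.Z = p.2.1.S}

/-- The conditional information cost `I(B ; Π | D, M)` with respect to `ψ_n`.  As usual, the public
string `R` is conditioned on: this is `I(B ; Π | D, M, R)`, the mean over `r` of
`I(B ; Π | D, M, R = r)`.  Since `R` is independent of the input, it is also
`I(B ; (R, Π) | D, M)`.  Without public randomness it is literally `I(B ; Π | D, M)`. -/
noncomputable def infoCost : ℝ :=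
  ∫ r, condMutualInfo P.law (fun p => p.1.B) (fun p => P.transcript r p.2 p.1.B)
    (fun p => p.1.Z) ∂P.pubLaw

end Protocol

end KGuess

/-! Fix the public string. The law of the transcript on input `x` is then a product over the sites
of functions of the single `x i` (`prob_eq_prod`), and the information cost is the mean
Kullback-Leibler divergence of this law from the law that is left when only `(D, M)` is known
(`condMutualInfo_eq`).

The main point is that the special coordinate and an ordinary one can exchange roles. Let `ℓ` be
special and set the bit of a random other coordinate `m` to zero; on average over `m` this hardly
changes the success probability (`sum_le_sum_update_false`). An input with coordinate `m` zero can
also be read with `m` special of type `00` and `ℓ` ordinary (`bitLaw_inp`). In that reading the bits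
of the ordinary coordinates are independent, so the squared Hellinger distances caused by flipping
single bits at their special sites add up to at most a constant times the information
(`sum_hell_bitLaw_le`). Once coordinate `ℓ` is overwritten, nothing depends on `D ℓ`, so the effect
of a bit at the special site is the mean effect over all sites; summing over the sites costs the
factor `k` (`sum_influence`).

Changing the type at `ℓ` changes the bits of many sites at once. The product form makes
cut-and-paste available, and with the Euclidean geometry of the Hellinger distance the total change
is at most four times the sum of the single-site changes (`hell_le_four_mul_sum`). So if the cost is
small against `n / k`, the four types look alike and the predictor can only guess
(`success_le_of_product`).

This needs `n` large against `1 / δ ^ 2`. For smaller `n` a constant lower bound suffices, which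
comes from comparing directly with a predictor that sees only `(D, M)` (`success_le`). Both bounds
are affine in the cost, hence survive averaging over the public string (`successProb_le`). -/

namespace KGuess

/-! ### Hellinger distance, divergence and total variation on a finite set. -/

section Inequalities

variable {τ : Type*} (T : Finset τ)

/-- Twice the squared Hellinger distance of `p` and `q` on `T`. -/
noncomputable def hell (p q : τ → ℝ) : ℝ :=
  ∑ t ∈ T, (√(p t) - √(q t)) ^ 2

variable {T}

lemma hell_nonneg (p q : τ → ℝ) : 0 ≤ hell T p q :=
  Finset.sum_nonneg fun _ _ => sq_nonneg _

lemma hell_comm (p q : τ → ℝ) : hell T p q = hell T q p :=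
  Finset.sum_congr rfl fun _ _ => by ring

lemma hell_self (p : τ → ℝ) : hell T p p = 0 := by simp [hell]

lemma hell_eq {p q : τ → ℝ} (hp : ∀ t, 0 ≤ p t) (hq : ∀ t, 0 ≤ q t)
    (hp1 : ∑ t ∈ T, p t = 1) (hq1 : ∑ t ∈ T, q t = 1) :
    hell T p q = 2 - 2 * ∑ t ∈ T, √(p t * q t) := by
  have : hell T p q = ∑ t ∈ T, (p t + q t - 2 * √(p t * q t)) :=
    Finset.sum_congr rfl fun t _ => by
      rw [Real.sqrt_mul (hp t), sub_sq, Real.sq_sqrt (hp t), Real.sq_sqrt (hq t)]; ring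
  rw [this, Finset.sum_sub_distrib, Finset.sum_add_distrib, hp1, hq1, ← Finset.mul_sum]
  norm_num

/-- The Hellinger distance is Euclidean: weak triangle inequality for its square. -/
lemma hell_le_two_mul (p q r : τ → ℝ) :
    hell T p q ≤ 2 * (hell T p r + hell T q r) := by
  unfold hell
  rw [← Finset.sum_add_distrib, Finset.mul_sum]
  refine Finset.sum_le_sum fun t _ => ?_
  nlinarith [sq_nonneg (√(p t) + √(q t) - 2 * √(r t))]

/-- The Gibbs inequality, term by term. -/
lemma sub_le_mul_log_sub_log {a b : ℝ} (ha : 0 ≤ a) (hb : 0 ≤ b) (h : b = 0 → a = 0) :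
    a - b ≤ a * (Real.log a - Real.log b) := by
  rcases ha.eq_or_lt with rfl | ha
  · simpa using hb
  have hb' : 0 < b := hb.lt_of_ne fun e => ha.ne' (h e.symm)
  have := Real.log_le_sub_one_of_pos (div_pos hb' ha)
  rw [Real.log_div hb'.ne' ha.ne'] at this
  have h2 := mul_le_mul_of_nonneg_left this ha.le
  have : a * (b / a - 1) = b - a := by field_simp
  nlinarith

/-- The Kullback-Leibler divergence dominates the squared Hellinger distance. -/
lemma hell_le_kl {p q : τ → ℝ} (hp : ∀ t, 0 ≤ p t) (hq : ∀ t, 0 ≤ q t)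
    (hp1 : ∑ t ∈ T, p t = 1) (hq1 : ∑ t ∈ T, q t = 1) (h : ∀ t, q t = 0 → p t = 0) :
    hell T p q ≤ ∑ t ∈ T, p t * (Real.log (p t) - Real.log (q t)) := by
  rw [hell_eq hp hq hp1 hq1]
  have key : ∑ t ∈ T, (2 * p t - 2 * √(p t * q t))
      ≤ ∑ t ∈ T, p t * (Real.log (p t) - Real.log (q t)) := by
    refine Finset.sum_le_sum fun t _ => ?_
    rcases (hp t).eq_or_lt with e | e
    · simp [← e]
    have hq' : 0 < q t := (hq t).lt_of_ne fun e' => e.ne' (h t e'.symm)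
    -- Comparing `p` with the geometric mean of `p` and `q` gives half of the divergence term.
    have := sub_le_mul_log_sub_log (hp t) (Real.sqrt_nonneg (p t * q t))
      (fun h0 => absurd h0 (by positivity))
    rw [Real.log_sqrt (by positivity), Real.log_mul e.ne' hq'.ne'] at this
    nlinarith
  rw [Finset.sum_sub_distrib, ← Finset.mul_sum, ← Finset.mul_sum, hp1] at key
  linarith

/-- Cauchy-Schwarz for `|p - q| = |√p - √q| (√p + √q)`, written with a free parameter `c` in place
of a square root. The bound is thus linear in `hell` and can be averaged without a concavity
argument. -/
lemma sum_abs_sub_le {p q : τ → ℝ} (hp : ∀ t, 0 ≤ p t) (hq : ∀ t, 0 ≤ q t)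
    (hp1 : ∑ t ∈ T, p t = 1) (hq1 : ∑ t ∈ T, q t = 1) {c : ℝ} (hc : 0 < c) :
    ∑ t ∈ T, |p t - q t| ≤ c + hell T p q / c := by
  have key : ∀ t ∈ T, |p t - q t| ≤ c / 2 * (p t + q t) + (√(p t) - √(q t)) ^ 2 / c := by
    intro t _
    set a := √(p t) with ha
    set b := √(q t) with hb
    have hpa : p t = a ^ 2 := (Real.sq_sqrt (hp t)).symm
    have hqb : q t = b ^ 2 := (Real.sq_sqrt (hq t)).symm
    rw [hpa, hqb, sq_sub_sq, abs_mul]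
    have h1 : |a + b| * |a - b| ≤ c / 4 * |a + b| ^ 2 + |a - b| ^ 2 / c := by
      have : c / 4 * |a + b| ^ 2 + |a - b| ^ 2 / c - |a + b| * |a - b|
          = (c / 2 * |a + b| - |a - b|) ^ 2 / c := by field_simp; ring
      have : 0 ≤ (c / 2 * |a + b| - |a - b|) ^ 2 / c := by positivity
      linarith
    rw [sq_abs, sq_abs] at h1
    have h2 : c / 4 * (a + b) ^ 2 ≤ c / 2 * (a ^ 2 + b ^ 2) := by nlinarith [sq_nonneg (a - b)]
    linarith
  refine (Finset.sum_le_sum key).trans_eq ?_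
  rw [Finset.sum_add_distrib, ← Finset.mul_sum, Finset.sum_add_distrib, hp1, hq1,
    ← Finset.sum_div, hell]
  ring

/-- A predictor that sees a sample of `p` does hardly better than one that sees a sample of `q`. -/
lemma sum_ite_le {p q : τ → ℝ} (hp : ∀ t, 0 ≤ p t) (hq : ∀ t, 0 ≤ q t)
    (hp1 : ∑ t ∈ T, p t = 1) (hq1 : ∑ t ∈ T, q t = 1) {c : ℝ} (hc : 0 < c)
    (E : τ → Prop) [DecidablePred E] :
    ∑ t ∈ T, (if E t then p t else 0)
      ≤ ∑ t ∈ T, (if E t then q t else 0) + (c + hell T p q / c) := by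
  refine le_trans ?_ (add_le_add_right (sum_abs_sub_le hp hq hp1 hq1 hc) _)
  rw [← Finset.sum_add_distrib]
  refine Finset.sum_le_sum fun t _ => ?_
  split_ifs
  · linarith [le_abs_self (p t - q t)]
  · simp

end Inequalities

/-! ### Hellinger distances of product-form families -/

section Cube

variable {τ ι : Type*} [DecidableEq ι] {T : Finset τ} {R : Finset ι → τ → ℝ}

/-- For probability vectors `hell` depends only on the pointwise products, and these agree by the
product form. -/
lemma hell_cut_paste (h0 : ∀ S t, 0 ≤ R S t) (h1 : ∀ S, ∑ t ∈ T, R S t = 1)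
    (hR : ∀ S S', Disjoint S S' → ∀ t, R S t * R S' t = R ∅ t * R (S ∪ S') t)
    {S S' : Finset ι} (h : Disjoint S S') :
    hell T (R S) (R S') = hell T (R ∅) (R (S ∪ S')) := by
  rw [hell_eq (h0 _) (h0 _) (h1 _) (h1 _), hell_eq (h0 _) (h0 _) (h1 _) (h1 _)]
  simp only [hR S S' h]

/-- The defect is exactly twice the square of `∑ j, (z - a j)`; it vanishes when `z` is the mean. -/
lemma sum_sum_sub_sq_le {α : Type*} [Fintype α] (a : α → ℝ) (z : ℝ) :
    ∑ i, ∑ j, (a i - a j) ^ 2 ≤ 2 * Fintype.card α * ∑ j, (z - a j) ^ 2 := by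
  have : ∑ i, ∑ j, (a i - a j) ^ 2
      = 2 * Fintype.card α * ∑ j, (z - a j) ^ 2 - 2 * (∑ j, (z - a j)) ^ 2 := by
    have e : ∀ i j, (a i - a j) ^ 2
      = (z - a i) ^ 2 + (z - a j) ^ 2 - 2 * ((z - a i) * (z - a j)) := fun i j => by ring
    simp only [e, Finset.sum_sub_distrib, Finset.sum_add_distrib, Finset.sum_const,
      Finset.card_univ, nsmul_eq_mul, ← Finset.mul_sum, ← Finset.sum_mul]
    ring
  rw [this]
  linarith [sq_nonneg (∑ j, (z - a j))]

lemma sum_sum_hell_le {α : Type*} [Fintype α] (p : α → τ → ℝ) (r : τ → ℝ) :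
    ∑ i, ∑ j, hell T (p i) (p j) ≤ 2 * Fintype.card α * ∑ j, hell T r (p j) := by
  unfold hell
  calc _ = ∑ t ∈ T, ∑ i, ∑ j, (√(p i t) - √(p j t)) ^ 2 := by
        simp_rw [Finset.sum_comm (t := T)]
    _ ≤ ∑ t ∈ T, 2 * Fintype.card α * ∑ j, (√(r t) - √(p j t)) ^ 2 :=
        Finset.sum_le_sum fun t _ => sum_sum_sub_sq_le _ _
    _ = _ := by rw [← Finset.mul_sum, Finset.sum_comm]

lemma exists_perm_apply_eq {α : Type*} [DecidableEq α] {x y x' y' : α} (h : x ≠ y)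
    (h' : x' ≠ y') : ∃ σ : Equiv.Perm α, σ x = x' ∧ σ y = y' := by
  refine ⟨Equiv.swap (Equiv.swap x x' y) y' * Equiv.swap x x', ?_, ?_⟩
  · rw [Equiv.Perm.mul_apply, Equiv.swap_apply_left, Equiv.swap_apply_of_ne_of_ne _ h']
    intro e
    have : Equiv.swap x x' x = Equiv.swap x x' y := by rw [Equiv.swap_apply_left]; exact e
    exact h ((Equiv.swap x x').injective this)
  · simp [Equiv.Perm.mul_apply]

/-- The mean over all permutations of a function of the images of two points. -/
lemma card_mul_sum_perm {α : Type*} [Fintype α] [DecidableEq α] (G : α → α → ℝ)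
    {x y : α} (h : x ≠ y) :
    (Fintype.card α * (Fintype.card α - 1) : ℝ) * ∑ σ : Equiv.Perm α, G (σ x) (σ y)
      = Fintype.card (Equiv.Perm α) * ∑ i, ∑ j, if i = j then 0 else G i j := by
  -- The symmetric group is doubly transitive, so the sum over `σ` is the same for every pair of
  -- distinct points.
  have e1 : ∀ x' y', (if x' = y' then 0 else ∑ σ : Equiv.Perm α, G (σ x') (σ y'))
      = if x' = y' then 0 else ∑ σ : Equiv.Perm α, G (σ x) (σ y) := by
    intro x' y'
    split_ifs with h'
    · rfl
    obtain ⟨τ, rfl, rfl⟩ := exists_perm_apply_eq h h'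
    symm
    exact Fintype.sum_equiv (Equiv.mulRight τ⁻¹) _ _ fun σ => by simp
  have e2 : ∀ σ : Equiv.Perm α, ∑ i, ∑ j, (if i = j then 0 else G (σ i) (σ j))
      = ∑ i, ∑ j, if i = j then 0 else G i j := by
    intro σ
    refine Fintype.sum_equiv σ _ _ fun i => Fintype.sum_equiv σ _ _ fun j => ?_
    simp
  calc _ = ∑ x', ∑ y', if x' = y' then 0 else ∑ σ : Equiv.Perm α, G (σ x) (σ y) := by
        have : ∀ x' : α, ∑ y', (if x' = y' then 0 else ∑ σ : Equiv.Perm α, G (σ x) (σ y))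
            = (Fintype.card α - 1 : ℝ) * ∑ σ : Equiv.Perm α, G (σ x) (σ y) := by
          intro x'
          have : ∀ y', (if x' = y' then 0 else ∑ σ : Equiv.Perm α, G (σ x) (σ y))
            = ∑ σ : Equiv.Perm α, G (σ x) (σ y)
              - if x' = y' then ∑ σ : Equiv.Perm α, G (σ x) (σ y) else 0 := by
            intro y'; split_ifs <;> simp
          simp only [this, Finset.sum_sub_distrib, Finset.sum_ite_eq, Finset.mem_univ, if_true,
            Finset.sum_const, Finset.card_univ, nsmul_eq_mul]
          ring
        rw [Finset.sum_congr rfl fun x' _ => this x', Finset.sum_const, Finset.card_univ,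
          nsmul_eq_mul]
        ring
    _ = ∑ x', ∑ y', ∑ σ : Equiv.Perm α, if x' = y' then 0 else G (σ x') (σ y') := by
        refine Finset.sum_congr rfl fun x' _ => Finset.sum_congr rfl fun y' _ => ?_
        rw [← e1]; split_ifs <;> simp
    _ = ∑ σ : Equiv.Perm α, ∑ x', ∑ y', if x' = y' then 0 else G (σ x') (σ y') := by
        exact (Finset.sum_congr rfl fun x' _ => Finset.sum_comm).trans Finset.sum_comm
    _ = _ := by simp only [e2, Finset.sum_const, Finset.card_univ, nsmul_eq_mul]

/-- The partial products of Euler's function at `1/2`. -/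
noncomputable def eulerHalf (s : ℕ) : ℝ := ∏ i ∈ Finset.range s, (1 - (1 / 2 : ℝ) ^ (i + 1))

lemma quarter_le_eulerHalf (s : ℕ) : 1 / 4 ≤ eulerHalf s := by
  -- The extra term makes the induction close: `(1/4 + x) (1 - x) ≥ 1/4 + x/2` for `0 ≤ x ≤ 1/4`.
  have key : ∀ s : ℕ, 1 / 4 + (1 / 2 : ℝ) ^ (s + 2) ≤ eulerHalf (s + 1) := by
    intro s
    induction s with
    | zero => norm_num [eulerHalf]
    | succ s ih =>
      rw [eulerHalf, Finset.prod_range_succ, ← eulerHalf]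
      have hx : (1 / 2 : ℝ) ^ (s + 2) ≤ 1 / 4 := by
        calc (1 / 2 : ℝ) ^ (s + 2) = (1 / 2) ^ s * (1 / 4) := by ring
          _ ≤ 1 * (1 / 4) := by gcongr; exact pow_le_one₀ (by norm_num) (by norm_num)
          _ = _ := by ring
      have hx0 : 0 < (1 / 2 : ℝ) ^ (s + 2) := by positivity
      have e1 : (1 / 2 : ℝ) ^ (s + 1 + 2) = (1 / 2) ^ (s + 2) / 2 := by ring
      have e2 : (1 / 2 : ℝ) ^ (s + 1 + 1) = (1 / 2) ^ (s + 2) := by ring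
      rw [e1, e2]
      nlinarith
  cases s with
  | zero => norm_num [eulerHalf]
  | succ s => exact le_trans (by linarith [show (0 : ℝ) < (1 / 2) ^ (s + 2) by positivity]) (key s)

/-- Halve the number `N = 2 ^ (s + 1)` of blocks by uniting them along a random perfect matching. By
cut-and-paste the distance for a united pair is the distance between its two members, and the
Euclidean inequality bounds the sum over all pairs by distances to `R ∅`. A uniformly random pair of
distinct blocks loses only the factor `1 - 1/N`; these factors multiply to `eulerHalf`. -/
lemma eulerHalf_mul_hell_le (h0 : ∀ S t, 0 ≤ R S t) (h1 : ∀ S, ∑ t ∈ T, R S t = 1)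
    (hR : ∀ S S', Disjoint S S' → ∀ t, R S t * R S' t = R ∅ t * R (S ∪ S') t) (s : ℕ) :
    ∀ A : Fin (2 ^ s) → Finset ι, (∀ i j, i ≠ j → Disjoint (A i) (A j)) →
      eulerHalf s * hell T (R ∅) (R (Finset.univ.biUnion A)) ≤ ∑ j, hell T (R ∅) (R (A j)) := by
  induction s with
  | zero =>
    intro A _
    simp [eulerHalf]
  | succ s ih =>
    intro A hA
    let e : Fin (2 ^ s) × Fin 2 ≃ Fin (2 ^ (s + 1)) := finProdFinEquiv
    set N : ℝ := (Fintype.card (Fin (2 ^ (s + 1))) : ℝ) with hN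
    have hN' : N = 2 * 2 ^ s := by simp [hN, pow_succ, mul_comm]
    have hpow : (1 : ℝ) ≤ 2 ^ s := one_le_pow₀ (by norm_num)
    set W : ℝ := ∑ i, ∑ j, if i = j then 0 else hell T (R ∅) (R (A i ∪ A j)) with hW
    set F : ℝ := (Fintype.card (Equiv.Perm (Fin (2 ^ (s + 1)))) : ℝ) with hF
    have hF0 : 0 < F := by rw [hF]; exact_mod_cast Fintype.card_pos
    have hne : ∀ b : Fin (2 ^ s), e (b, 0) ≠ e (b, 1) := fun b h => by
      have := e.injective h
      simp at this
    have step : ∀ σ : Equiv.Perm (Fin (2 ^ (s + 1))),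
        eulerHalf s * hell T (R ∅) (R (Finset.univ.biUnion A))
          ≤ ∑ b, hell T (R ∅) (R (A (σ (e (b, 0))) ∪ A (σ (e (b, 1))))) := by
      intro σ
      have := ih (fun b => A (σ (e (b, 0))) ∪ A (σ (e (b, 1)))) (by
        intro b b' hb
        have hh : ∀ c c', Disjoint (A (σ (e (b, c)))) (A (σ (e (b', c')))) := fun c c' =>
          hA _ _ fun h => hb (congrArg Prod.fst (e.injective (σ.injective h)))
        simp only [Finset.disjoint_union_left, Finset.disjoint_union_right]
        exact ⟨⟨hh _ _, hh _ _⟩, hh _ _, hh _ _⟩)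
      convert this using 4
      ext x
      simp only [Finset.mem_biUnion, Finset.mem_univ, true_and, Finset.mem_union]
      constructor
      · rintro ⟨a, ha⟩
        obtain ⟨⟨b, c⟩, hbc⟩ := e.surjective (σ.symm a)
        refine ⟨b, ?_⟩
        have : σ (e (b, c)) = a := by rw [hbc]; simp
        fin_cases c
        · left; simpa [this] using this ▸ ha
        · right; simpa [this] using this ▸ ha
      · rintro ⟨b, h | h⟩ <;> exact ⟨_, h⟩
    have sumstep := Finset.sum_le_sum fun σ (_ : σ ∈ Finset.univ) => step σ
    rw [Finset.sum_const, Finset.card_univ, nsmul_eq_mul, ← hF, Finset.sum_comm] at sumstep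
    have hb : ∀ b : Fin (2 ^ s), (N * (N - 1)) * ∑ σ : Equiv.Perm (Fin (2 ^ (s + 1))),
        hell T (R ∅) (R (A (σ (e (b, 0))) ∪ A (σ (e (b, 1))))) = F * W := fun b =>
      card_mul_sum_perm (fun i j => hell T (R ∅) (R (A i ∪ A j))) (hne b)
    have hpair : W ≤ 2 * N * ∑ j, hell T (R ∅) (R (A j)) := by
      refine le_trans (le_of_eq ?_) (sum_sum_hell_le (fun j => R (A j)) (R ∅))
      refine Finset.sum_congr rfl fun i _ => Finset.sum_congr rfl fun j _ => ?_
      split_ifs with h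
      · rw [h, hell_self]
      · exact (hell_cut_paste h0 h1 hR (hA i j h)).symm
    have hNpos : 0 < N * (N - 1) := by rw [hN']; nlinarith
    have h3 : (N * (N - 1)) * (F * (eulerHalf s * hell T (R ∅) (R (Finset.univ.biUnion A))))
        ≤ 2 ^ s * (F * W) := by
      refine (mul_le_mul_of_nonneg_left sumstep hNpos.le).trans_eq ?_
      rw [Finset.mul_sum, Finset.sum_congr rfl fun b _ => hb b]
      simp
    have h4 : (N * (N - 1)) * (eulerHalf s * hell T (R ∅) (R (Finset.univ.biUnion A)))
        ≤ 2 ^ s * W := by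
      refine le_of_mul_le_mul_left ?_ hF0
      linarith
    have hNp : 0 < N := by rw [hN']; positivity
    have h5 : (N - 1) * (eulerHalf s * hell T (R ∅) (R (Finset.univ.biUnion A)))
        ≤ N * ∑ j, hell T (R ∅) (R (A j)) := by
      refine le_of_mul_le_mul_left ?_ hNp
      have := mul_le_mul_of_nonneg_left hpair (by positivity : (0 : ℝ) ≤ 2 ^ s)
      calc _ = _ := by ring
        _ ≤ _ := h4.trans this
        _ = _ := by rw [hN']; ring
    refine le_of_mul_le_mul_left ?_ hNp
    refine le_trans (le_of_eq ?_) h5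
    have : N * (1 - (1 / 2 : ℝ) ^ (s + 1)) = N - 1 := by
      have h2 : (2 : ℝ) ^ s * (1 / 2) ^ s = 1 := by rw [← mul_pow]; norm_num
      rw [hN', pow_succ]; linear_combination (-1 : ℝ) * h2
    rw [eulerHalf, Finset.prod_range_succ, ← eulerHalf, ← this]
    ring

/-- In a family of product form, the squared Hellinger distance that results from changing several
coordinates is at most four times the sum of those that result from changing one of them. -/
theorem hell_le_four_mul_sum [Fintype ι] (h0 : ∀ S t, 0 ≤ R S t)
    (h1 : ∀ S, ∑ t ∈ T, R S t = 1)
    (hR : ∀ S S', Disjoint S S' → ∀ t, R S t * R S' t = R ∅ t * R (S ∪ S') t) (S : Finset ι) :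
    hell T (R ∅) (R S) ≤ 4 * ∑ i, hell T (R ∅) (R {i}) := by
  obtain ⟨f⟩ : Nonempty (ι ↪ Fin (2 ^ Fintype.card ι)) :=
    -- Padding to a power of two: unused indices, and those outside `S`, get the empty block, which
    -- contributes nothing.
    Function.Embedding.nonempty_of_card_le (by simpa using Nat.lt_two_pow_self.le)
  let A : Fin (2 ^ Fintype.card ι) → Finset ι := fun j => S.filter fun i => f i = j
  have key := eulerHalf_mul_hell_le h0 h1 hR (Fintype.card ι) A (by
    intro j j' h
    refine Finset.disjoint_left.2 fun i hi hi' => h ?_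
    simp only [A, Finset.mem_filter] at hi hi'
    exact hi.2.symm.trans hi'.2)
  have hU : Finset.univ.biUnion A = S := by
    ext i; simp [A]
  have hsum : ∑ j, hell T (R ∅) (R (A j)) ≤ ∑ i, hell T (R ∅) (R {i}) := by
    have hle : ∀ j, hell T (R ∅) (R (A j)) ≤ ∑ i, if f i = j then hell T (R ∅) (R {i}) else 0 := by
      intro j
      have hnn : ∀ i ∈ Finset.univ, 0 ≤ if f i = j then hell T (R ∅) (R {i}) else 0 := by
        intro i _; split_ifs
        · exact hell_nonneg _ _
        · rfl
      by_cases h : ∃ i ∈ S, f i = j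
      · obtain ⟨i, hi, rfl⟩ := h
        have : A (f i) = {i} := by
          ext i'; simp only [A, Finset.mem_filter, Finset.mem_singleton]
          exact ⟨fun h => f.injective h.2, fun h => by subst h; exact ⟨hi, rfl⟩⟩
        rw [this]
        refine le_trans ?_ (Finset.single_le_sum hnn (Finset.mem_univ i))
        simp
      · have : A j = ∅ := by
          ext i'; simp only [A, Finset.mem_filter, Finset.notMem_empty, iff_false]
          exact fun h' => h ⟨i', h'⟩
        rw [this, hell_self]
        exact Finset.sum_nonneg hnn
    refine (Finset.sum_le_sum fun j _ => hle j).trans_eq ?_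
    rw [Finset.sum_comm]
    simp
  rw [hU] at key
  have := mul_le_mul_of_nonneg_right (quarter_le_eulerHalf (Fintype.card ι))
    (hell_nonneg (T := T) (R ∅) (R S))
  linarith

end Cube

end KGuess

namespace KGuess

/-! ### Sums over functions -/

section FunctionSums

variable {ι : Type*} [Fintype ι] [DecidableEq ι]

lemma sum_sum_update {α : Type*} [Fintype α] (j : ι) (G : (ι → α) → ℝ) :
    ∑ w : ι → α, ∑ v, G (Function.update w j v) = Fintype.card α * ∑ w, G w := by
  -- Swapping the value at `j` with the spare value is an involution.
  let e : (ι → α) × α ≃ (ι → α) × α :=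
    { toFun := fun p => (Function.update p.1 j p.2, p.1 j)
      invFun := fun p => (Function.update p.1 j p.2, p.1 j)
      left_inv := fun p => by simp
      right_inv := fun p => by simp }
  rw [← Fintype.sum_prod_type' (f := fun w v => G (Function.update w j v)),
    Fintype.sum_equiv e (fun p => G (Function.update p.1 j p.2)) (fun p => G p.1) fun p => rfl,
    Fintype.sum_prod_type]
  simp [Finset.mul_sum]

lemma sum_prod_eval {α : Type*} [Fintype α] (F : ι → α → ℝ) :
    ∑ w : ι → α, ∏ j, F j (w j) = ∏ j, ∑ v, F j v := by
  rw [Finset.prod_univ_sum, Fintype.piFinset_univ]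

lemma sum_update_false (m : ι) (f : (ι → Bool) → ℝ) :
    ∑ A : ι → Bool, f (Function.update A m false)
      = 2 * ∑ A : ι → Bool, if A m then 0 else f A := by
  have := sum_sum_update m fun A : ι → Bool => if A m then 0 else f A
  simpa using this

/-- A bounded function of independent fair bits has about the same mean when a random one of these
bits is set to `0`. -/
lemma sum_le_sum_update_false (f : (ι → Bool) → ℝ) {C c : ℝ} (h0 : ∀ A, 0 ≤ f A)
    (hC : ∀ A, f A ≤ C) (hc : 0 < c) (s : Finset ι) (hs : s.Nonempty) :
    ∑ A, f A ≤ (∑ m ∈ s, ∑ A, f (Function.update A m false)) / s.card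
      + Fintype.card (ι → Bool) * (C * (c + 1 / (c * s.card))) := by
  set d : ℝ := (s.card : ℝ) with hd
  have hd0 : 0 < d := by rw [hd]; exact_mod_cast hs.card_pos
  let ε : ι → (ι → Bool) → ℝ := fun m A => if A m then 1 else -1
  set X : (ι → Bool) → ℝ := fun A => (∑ m ∈ s, ε m A) / d with hX
  have hεε : ∀ m m', ∑ A, ε m A * ε m' A = if m = m' then (Fintype.card (ι → Bool) : ℝ) else 0 := by
    intro m m'
    split_ifs with h
    · subst h
      have : ∀ A, ε m A * ε m A = 1 := fun A => by simp only [ε]; split_ifs <;> norm_num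
      simp only [this, Finset.sum_const, Finset.card_univ, nsmul_eq_mul, mul_one]
    · have := sum_sum_update m fun A : ι → Bool => ε m A * ε m' A
      have h2 : ∀ A : ι → Bool, ∑ v, ε m (Function.update A m v) * ε m' (Function.update A m v)
          = 0 := by
        intro A
        simp [ε, Function.update_of_ne (Ne.symm h)]
      rw [Finset.sum_congr rfl fun A _ => h2 A] at this
      simp only [Finset.sum_const_zero, Fintype.card_bool] at this
      push_cast at this
      linarith
  have hX2 : ∑ A, X A ^ 2 = Fintype.card (ι → Bool) / d := by
    have : ∀ A, X A ^ 2 = (∑ m ∈ s, ∑ m' ∈ s, ε m A * ε m' A) / d ^ 2 := fun A => by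
      rw [← Finset.sum_mul_sum, hX]; ring
    rw [Finset.sum_congr rfl fun A _ => this A, ← Finset.sum_div, Finset.sum_comm,
      Finset.sum_congr rfl fun m _ => Finset.sum_comm]
    simp only [hεε, Finset.sum_ite_eq]
    rw [Finset.sum_congr rfl fun m hm => if_pos hm, Finset.sum_const, nsmul_eq_mul, ← hd]
    field_simp
  -- Forcing bit `m` to zero reweights the uniform law by `1 - ε m`. The mean over `m` has weight `1
  -- - X`, where the average sign `X` has second moment `1 / d`.
  have e1 : (∑ m ∈ s, ∑ A, f (Function.update A m false)) / d = ∑ A, f A * (1 - X A) := by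
    simp only [sum_update_false]
    rw [← Finset.mul_sum, Finset.sum_comm, Finset.mul_sum, Finset.sum_div]
    refine Finset.sum_congr rfl fun A _ => ?_
    have : ∀ m, (if A m then 0 else f A) = f A * ((1 - ε m A) / 2) := fun m => by
      simp only [ε]; split_ifs <;> ring
    simp only [this, hX, ← Finset.mul_sum, ← Finset.sum_div, Finset.sum_sub_distrib,
      Finset.sum_const, nsmul_eq_mul, ← hd]
    field_simp
  have e2 : ∀ A, f A ≤ f A * (1 - X A) + C * (c + X A ^ 2 / c) := by
    intro A
    have h1 : X A ≤ c + X A ^ 2 / c := by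
      rcases le_total (X A) c with h | h
      · have : 0 ≤ X A ^ 2 / c := by positivity
        linarith
      · have : X A ≤ X A ^ 2 / c := by rw [le_div_iff₀ hc]; nlinarith
        linarith
    have h2 : 0 ≤ c + X A ^ 2 / c := by positivity
    nlinarith [h0 A, hC A, mul_le_mul_of_nonneg_left h1 (h0 A),
      mul_le_mul_of_nonneg_right (hC A) h2]
  rw [e1]
  refine (Finset.sum_le_sum fun A _ => e2 A).trans_eq ?_
  rw [Finset.sum_add_distrib, ← Finset.mul_sum, Finset.sum_add_distrib, ← Finset.sum_div, hX2]
  simp only [Finset.sum_const, Finset.card_univ, nsmul_eq_mul]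
  field_simp

/-- If every factor depends only on the bits of its own block, then the factors are independent. -/
lemma prod_sum_eq_of_blocks {κ : Type*} [Fintype κ] [DecidableEq κ] (D : ι → κ)
    (G : κ → (ι → Bool) → ℝ)
    (hG : ∀ i A A', (∀ j, D j = i → A j = A' j) → G i A = G i A') :
    (∑ A, ∏ i, G i A) / Fintype.card (ι → Bool)
      = ∏ i, (∑ A, G i A) / Fintype.card (ι → Bool) := by
  set K : ℝ := (Fintype.card (ι → Bool) : ℝ) with hK
  have hK0 : K ≠ 0 := by rw [hK]; exact_mod_cast Fintype.card_ne_zero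
  let Φ : (ι → Bool) → ℝ := fun A => ∏ i, G i A
  -- Give every block its own independent copy of all bits; `diag` reads each bit from the copy of
  -- its block, which leaves every factor unchanged.
  let diag : (κ → ι → Bool) → ι → Bool := fun A' j => A' (D j) j
  have e1 : ∏ i, ∑ A, G i A = ∑ A' : κ → ι → Bool, Φ (diag A') := by
    rw [← sum_prod_eval]
    refine Finset.sum_congr rfl fun A' _ => Finset.prod_congr rfl fun i _ => ?_
    exact hG _ _ _ fun j hj => by simp [diag, hj]
  -- Shifting by a common `C` preserves the sum over the copies; summing over `C` first then makes
  -- the diagonal uniform.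
  have e2 : ∀ C : ι → Bool, ∑ A' : κ → ι → Bool, Φ (diag A')
      = ∑ A' : κ → ι → Bool, Φ (fun j => xor (diag A' j) (C j)) := by
    intro C
    let e : (κ → ι → Bool) ≃ (κ → ι → Bool) :=
      Function.Involutive.toPerm (fun A' i j => xor (A' i j) (C j)) fun A' => by
        funext i j; simp
    exact (Fintype.sum_equiv e _ _ fun A' => rfl).symm
  have e3 : ∀ A' : κ → ι → Bool, ∑ C : ι → Bool, Φ (fun j => xor (diag A' j) (C j))
      = ∑ A, Φ A := by
    intro A'
    let e : (ι → Bool) ≃ (ι → Bool) :=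
      Function.Involutive.toPerm (fun C j => xor (diag A' j) (C j)) fun C => by
        funext j; simp
    exact Fintype.sum_equiv e _ _ fun C => rfl
  have e4 : K * ∏ i, ∑ A, G i A = K ^ Fintype.card κ * ∑ A, Φ A := by
    calc K * ∏ i, ∑ A, G i A = ∑ C : ι → Bool, ∑ A' : κ → ι → Bool, Φ (diag A') := by
          rw [e1, Finset.sum_const, Finset.card_univ, nsmul_eq_mul]
      _ = ∑ A' : κ → ι → Bool, ∑ C : ι → Bool, Φ (fun j => xor (diag A' j) (C j)) := by
          rw [Finset.sum_congr rfl fun C _ => e2 C, Finset.sum_comm]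
      _ = _ := by
          rw [Finset.sum_congr rfl fun A' _ => e3 A', Finset.sum_const, Finset.card_univ,
            nsmul_eq_mul, Fintype.card_fun (α := κ)]
          push_cast; rfl
  rw [Finset.prod_div_distrib, Finset.prod_const, Finset.card_univ, div_eq_div_iff hK0
    (pow_ne_zero _ hK0)]
  linarith [e4]

end FunctionSums

/-! ### Information about independent bits -/

section Superadditivity

variable {ι τ : Type*} [Fintype ι] [DecidableEq ι] {T : Finset τ} {P : (ι → Bool) → τ → ℝ}

/-- The law of the output when the input consists of fair bits, but for bit `j`, which is `v`. -/
noncomputable def bitLaw (P : (ι → Bool) → τ → ℝ) (j : ι) (v : Bool) (t : τ) : ℝ :=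
  (∑ w, P (Function.update w j v) t) / Fintype.card (ι → Bool)

/-- The law of the output when the input consists of fair bits. -/
noncomputable def meanLaw (P : (ι → Bool) → τ → ℝ) (t : τ) : ℝ :=
  (∑ w, P w t) / Fintype.card (ι → Bool)

lemma card_bits_pos : (0 : ℝ) < Fintype.card (ι → Bool) := by exact_mod_cast Fintype.card_pos

lemma sum_mean {α : Type*} [Fintype α] [Nonempty α] {f : α → τ → ℝ}
    (h : ∀ a, ∑ t ∈ T, f a t = 1) : ∑ t ∈ T, (∑ a, f a t) / Fintype.card α = 1 := by
  rw [← Finset.sum_div, Finset.sum_comm]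
  have : (Fintype.card α : ℝ) ≠ 0 := by exact_mod_cast Fintype.card_ne_zero
  simp [h, this]

lemma bitLaw_nonneg (h0 : ∀ w t, 0 ≤ P w t) (j : ι) (v : Bool) (t : τ) : 0 ≤ bitLaw P j v t :=
  div_nonneg (Finset.sum_nonneg fun _ _ => h0 _ _) card_bits_pos.le

lemma meanLaw_nonneg (h0 : ∀ w t, 0 ≤ P w t) (t : τ) : 0 ≤ meanLaw P t :=
  div_nonneg (Finset.sum_nonneg fun _ _ => h0 _ _) card_bits_pos.le

lemma sum_bitLaw (P : (ι → Bool) → τ → ℝ) (j : ι) (t : τ) :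
    ∑ v, bitLaw P j v t = 2 * meanLaw P t := by
  have := sum_sum_update j fun w => P w t
  unfold bitLaw meanLaw
  rw [← Finset.sum_div, Finset.sum_comm, this, mul_div_assoc]
  simp

lemma meanLaw_pos (h0 : ∀ w t, 0 ≤ P w t) {w : ι → Bool} {t : τ} (h : 0 < P w t) :
    0 < meanLaw P t :=
  div_pos (h.trans_le (Finset.single_le_sum (fun w _ => h0 w t) (Finset.mem_univ w)))
    card_bits_pos

lemma bitLaw_pos (h0 : ∀ w t, 0 ≤ P w t) {w : ι → Bool} {t : τ} (h : 0 < P w t) (j : ι) :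
    0 < bitLaw P j (w j) t := by
  refine div_pos (h.trans_le ?_) card_bits_pos
  have := Finset.single_le_sum (f := fun w' => P (Function.update w' j (w j)) t)
    (fun w' _ => h0 _ t) (Finset.mem_univ w)
  simpa using this

/-- Independent bits: the information about all of them is at least the sum of the informations
about the single bits, which dominate Hellinger distances. -/
theorem sum_hell_bitLaw_le (h0 : ∀ w t, 0 ≤ P w t) (h1 : ∀ w, ∑ t ∈ T, P w t = 1)
    {Q : τ → ℝ} (hQ0 : ∀ t, 0 ≤ Q t) (hQ1 : ∑ t ∈ T, Q t = 1)
    (hQ : ∀ t, Q t = 0 → ∀ w, P w t = 0) :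
    Fintype.card (ι → Bool) / 4 * ∑ j, hell T (bitLaw P j false) (bitLaw P j true)
      ≤ ∑ w, ∑ t ∈ T, P w t * (Real.log (P w t) - Real.log (Q t)) := by
  set K : ℝ := (Fintype.card (ι → Bool) : ℝ) with hK
  have hK0 : 0 < K := card_bits_pos
  have single : ∀ j, K / 4 * hell T (bitLaw P j false) (bitLaw P j true)
      ≤ ∑ w, ∑ t ∈ T, P w t * (Real.log (bitLaw P j (w j) t) - Real.log (meanLaw P t)) := by
    intro j
    have hb1 : ∀ v, ∑ t ∈ T, bitLaw P j v t = 1 := fun v => sum_mean fun w => h1 _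
    have hm1 : ∑ t ∈ T, meanLaw P t = 1 := sum_mean h1
    have hkl : ∀ v, hell T (bitLaw P j v) (meanLaw P) ≤ ∑ t ∈ T, bitLaw P j v t *
        (Real.log (bitLaw P j v t) - Real.log (meanLaw P t)) := fun v =>
      hell_le_kl (bitLaw_nonneg h0 j v) (meanLaw_nonneg h0) (hb1 v) hm1 fun t ht => by
        have h2 := sum_bitLaw P j t
        rw [ht, mul_zero, Finset.sum_eq_zero_iff_of_nonneg fun v _ => bitLaw_nonneg h0 j v t] at h2
        exact h2 v (Finset.mem_univ v)
    have e : ∑ w, ∑ t ∈ T, P w t * (Real.log (bitLaw P j (w j) t) - Real.log (meanLaw P t))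
        = K / 2 * ∑ v, ∑ t ∈ T, bitLaw P j v t *
          (Real.log (bitLaw P j v t) - Real.log (meanLaw P t)) := by
      rw [Finset.sum_comm, Finset.sum_comm (t := T), Finset.mul_sum]
      refine Finset.sum_congr rfl fun t _ => ?_
      have := sum_sum_update j fun w =>
        P w t * (Real.log (bitLaw P j (w j) t) - Real.log (meanLaw P t))
      rw [Finset.sum_comm] at this
      simp only [Function.update_self, ← Finset.sum_mul, Fintype.card_bool] at this
      have h2 : ∀ v, ∑ w, P (Function.update w j v) t = K * bitLaw P j v t := fun v => by
        rw [bitLaw, ← hK]; field_simp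
      simp only [h2] at this
      rw [eq_comm, ← mul_right_inj' (two_ne_zero (α := ℝ)), ← mul_assoc, mul_div_cancel₀ _
        two_ne_zero, Finset.mul_sum]
      push_cast at this
      rw [← this]
      exact Finset.sum_congr rfl fun v _ => by ring
    rw [e]
    -- The factor 2 of the weak triangle inequality turns `K / 2` into `K / 4`.
    have h3 := hell_le_two_mul (T := T) (bitLaw P j false) (bitLaw P j true) (meanLaw P)
    have h4 := hkl true
    have h5 := hkl false
    rw [Fintype.sum_bool]
    nlinarith
  have main : ∑ j, ∑ w, ∑ t ∈ T, P w t *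
      (Real.log (bitLaw P j (w j) t) - Real.log (meanLaw P t))
      ≤ ∑ w, ∑ t ∈ T, P w t * (Real.log (P w t) - Real.log (Q t)) := by
    -- The law that would hold if the bits stayed independent given the output, with output law `Q`.
    -- Gibbs' inequality against it gives superadditivity for every reference `Q`, not only for
    -- `meanLaw P`.
    let b : (ι → Bool) → τ → ℝ := fun w t => Q t * ∏ j, (bitLaw P j (w j) t / meanLaw P t)
    have hb0 : ∀ w t, 0 ≤ b w t := fun w t => mul_nonneg (hQ0 t)
      (Finset.prod_nonneg fun j _ => div_nonneg (bitLaw_nonneg h0 _ _ _) (meanLaw_nonneg h0 _))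
    have hbsum : ∑ w, ∑ t ∈ T, b w t ≤ K := by
      rw [Finset.sum_comm]
      have : ∀ t ∈ T, ∑ w, b w t ≤ Q t * K := by
        intro t _
        simp only [b]
        rw [← Finset.mul_sum, sum_prod_eval fun j v => bitLaw P j v t / meanLaw P t]
        refine mul_le_mul_of_nonneg_left ?_ (hQ0 t)
        have hK2 : K = ∏ _j : ι, (2 : ℝ) := by simp [hK]
        rw [hK2]
        refine Finset.prod_le_prod (fun j _ => Finset.sum_nonneg fun v _ =>
          div_nonneg (bitLaw_nonneg h0 _ _ _) (meanLaw_nonneg h0 _)) fun j _ => ?_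
        rw [← Finset.sum_div, sum_bitLaw]
        -- Only an inequality, since the quotient is `0` where `meanLaw` vanishes; a total mass of
        -- at most `K` is enough.
        exact div_le_of_le_mul₀ (meanLaw_nonneg h0 t) zero_le_two le_rfl
      refine (Finset.sum_le_sum this).trans_eq ?_
      rw [← Finset.sum_mul, hQ1, one_mul]
    have hterm : ∀ w, ∀ t ∈ T, (∑ j, P w t *
        (Real.log (bitLaw P j (w j) t) - Real.log (meanLaw P t))) + (P w t - b w t)
        ≤ P w t * (Real.log (P w t) - Real.log (Q t)) := by
      intro w t _
      rcases (h0 w t).eq_or_lt with e | e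
      · simp [← e, hb0 w t]
      have hQt : Q t ≠ 0 := fun h => e.ne' (hQ t h w)
      have hm := meanLaw_pos h0 e
      have hbj := bitLaw_pos h0 e
      have hprod : ∏ j, (bitLaw P j (w j) t / meanLaw P t) ≠ 0 :=
        Finset.prod_ne_zero_iff.2 fun j _ => (div_pos (hbj j) hm).ne'
      have g := sub_le_mul_log_sub_log e.le (hb0 w t)
        fun h => absurd h (mul_ne_zero hQt hprod)
      have hl : Real.log (b w t) = Real.log (Q t) +
          ∑ j, (Real.log (bitLaw P j (w j) t) - Real.log (meanLaw P t)) := by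
        simp only [b]
        rw [Real.log_mul hQt hprod, Real.log_prod fun j _ => (div_pos (hbj j) hm).ne']
        congr 1
        exact Finset.sum_congr rfl fun j _ => Real.log_div (hbj j).ne' hm.ne'
      rw [hl] at g
      rw [← Finset.mul_sum]
      nlinarith
    have := Finset.sum_le_sum fun w (_ : w ∈ Finset.univ) => Finset.sum_le_sum (hterm w)
    simp only [Finset.sum_add_distrib, Finset.sum_sub_distrib, h1] at this
    rw [Finset.sum_comm, Finset.sum_congr rfl fun w _ => Finset.sum_comm]
    have hone : ∑ _w : ι → Bool, (1 : ℝ) = K := by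
      rw [Finset.sum_const, Finset.card_univ, nsmul_eq_mul, mul_one]
    rw [hone] at this
    linarith
  rw [Finset.mul_sum]
  exact (Finset.sum_le_sum fun j _ => single j).trans main

end Superadditivity

end KGuess

namespace KGuess

/-! ### The bound for protocols with finitely many transcripts -/

section Finite

variable {n k : ℕ} {τ : Type*}

lemma sum_sample (F : Sample n k → ℝ) :
    ∑ s, F s = ∑ D : Fin n → Fin k, ∑ m : Fin n, ∑ A : Fin n → Bool, ∑ U, ∑ V, F (D, m, A, U, V) := by
  simp only [Fintype.sum_prod_type]

lemma card_sample : (Fintype.card (Sample n k) : ℝ)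
    = 4 * ((k : ℝ) ^ n * n * Fintype.card (Fin n → Bool)) := by
  simp only [Sample, Fintype.card_prod, Fintype.card_bool, Fintype.card_fin, Fintype.card_fun]
  push_cast; ring

/-- The input in which the sites in `S` have the bit `1` in coordinate `ℓ`, and every other
coordinate is set by its special site. -/
def inp (D : Fin n → Fin k) (A : Fin n → Bool) (ℓ : Fin n) (S : Finset (Fin k)) :
    Fin k → Fin n → Bool := fun i j =>
  if j = ℓ then decide (i ∈ S) else if i = D j then A j else false

/-- The sites that have the bit `1` in the special coordinate. -/
def typeSites (k : ℕ) (U V : Bool) : Finset (Fin k) :=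
  Finset.univ.filter fun i => (if (i : ℕ) < k / 2 then U else V) = true

lemma sample_B (D : Fin n → Fin k) (m : Fin n) (A : Fin n → Bool) (U V : Bool) :
    Sample.B (D, m, A, U, V) = inp D A m (typeSites k U V) := by
  funext i j
  by_cases hj : j = m
  · simp [Sample.B, inp, Sample.M, Sample.U, Sample.V, typeSites, hj]
  · simp only [Sample.B, inp, Sample.D, Sample.A, Sample.M, hj, if_false]
    rfl

lemma typeSites_false : typeSites k false false = ∅ := by
  simp [typeSites]

lemma sample_S (hk : 0 < k) (he : Even k) (D : Fin n → Fin k) (m : Fin n) (A : Fin n → Bool)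
    (U V : Bool) : Sample.S (D, m, A, U, V) = (U, V) := by
  obtain ⟨j, rfl⟩ := he
  have hj : (j + j) / 2 = j := by omega
  refine Prod.ext ?_ ?_
  · rw [Bool.eq_iff_iff]
    simp only [Sample.S, Sample.B, Sample.M, Sample.U, Sample.V, if_true, hj, decide_eq_true_eq]
    refine ⟨fun h => ?_, fun h i hi => by simp [hi, h]⟩
    have := h ⟨0, hk⟩ (by simp; omega)
    simpa [show 0 < j by omega] using this
  · rw [Bool.eq_iff_iff]
    simp only [Sample.S, Sample.B, Sample.M, Sample.U, Sample.V, if_true, hj, decide_eq_true_eq]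
    refine ⟨fun h => ?_, fun h i hi => by simp [hi, h]⟩
    have := h ⟨j, by omega⟩ (by simp)
    simpa using this

variable (P : (Fin k → Fin n → Bool) → τ → ℝ) (T : Finset τ)

/-- The law of the transcript given `(D, M) = z`. -/
noncomputable def predLaw (z : (Fin n → Fin k) × Fin n) (t : τ) : ℝ :=
  (∑ a : (Fin n → Bool) × Bool × Bool, P (Sample.B (z.1, z.2, a)) t)
    / Fintype.card ((Fin n → Bool) × Bool × Bool)

/-- The information cost, in nats, of transcripts with the conditional laws `P`. -/
noncomputable def natCost : ℝ :=
  (∑ s : Sample n k, ∑ t ∈ T, P s.B t * (Real.log (P s.B t) - Real.log (predLaw P s.Z t)))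
    / Fintype.card (Sample n k)

/-- The success probability with transcripts that have the conditional laws `P`. -/
noncomputable def success (g : τ → (Fin n → Fin k) × Fin n → Bool × Bool) : ℝ :=
  (∑ s : Sample n k, ∑ t ∈ T, if g t s.Z = s.S then P s.B t else 0)
    / Fintype.card (Sample n k)

variable {P T}

lemma predLaw_nonneg (h0 : ∀ x t, 0 ≤ P x t) (z : (Fin n → Fin k) × Fin n) (t : τ) :
    0 ≤ predLaw P z t :=
  div_nonneg (Finset.sum_nonneg fun _ _ => h0 _ _) (Nat.cast_nonneg _)

lemma sum_predLaw (h1 : ∀ x, ∑ t ∈ T, P x t = 1) (z : (Fin n → Fin k) × Fin n) :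
    ∑ t ∈ T, predLaw P z t = 1 :=
  sum_mean fun _ => h1 _

lemma eq_zero_of_predLaw (h0 : ∀ x t, 0 ≤ P x t) {z : (Fin n → Fin k) × Fin n} {t : τ}
    (h : predLaw P z t = 0) (a : (Fin n → Bool) × Bool × Bool) :
    P (Sample.B (z.1, z.2, a)) t = 0 := by
  have hc : (Fintype.card ((Fin n → Bool) × Bool × Bool) : ℝ) ≠ 0 := by
    exact_mod_cast Fintype.card_ne_zero
  have := (div_eq_zero_iff.1 h).resolve_right hc
  exact (Finset.sum_eq_zero_iff_of_nonneg fun _ _ => h0 _ _).1 this a (Finset.mem_univ a)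

lemma hell_le_natCost_term (h0 : ∀ x t, 0 ≤ P x t) (h1 : ∀ x, ∑ t ∈ T, P x t = 1)
    (s : Sample n k) : hell T (P s.B) (predLaw P s.Z)
      ≤ ∑ t ∈ T, P s.B t * (Real.log (P s.B t) - Real.log (predLaw P s.Z t)) :=
  hell_le_kl (h0 _) (predLaw_nonneg h0 _) (h1 _) (sum_predLaw h1 _)
    fun _ ht => eq_zero_of_predLaw h0 ht s.2.2

lemma natCost_nonneg (h0 : ∀ x t, 0 ≤ P x t) (h1 : ∀ x, ∑ t ∈ T, P x t = 1) :
    0 ≤ natCost P T :=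
  div_nonneg (Finset.sum_nonneg fun s _ => (hell_nonneg _ _).trans (hell_le_natCost_term h0 h1 s))
    (Nat.cast_nonneg _)

lemma sum_ite_type (c : Bool × Bool) (x : ℝ) :
    ∑ U, ∑ V, (if c = (U, V) then x else 0) = x := by
  rcases c with ⟨_ | _, _ | _⟩ <;> simp

/-- A cheap predictor hardly beats random guessing. -/
theorem success_le (hk : 0 < k) (hn : 0 < n) (he : Even k)
    (h0 : ∀ x t, 0 ≤ P x t) (h1 : ∀ x, ∑ t ∈ T, P x t = 1)
    (g : τ → (Fin n → Fin k) × Fin n → Bool × Bool) {c : ℝ} (hc : 0 < c) :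
    success P T g ≤ 1 / 4 + c + natCost P T / c := by
  set N : ℝ := (Fintype.card (Sample n k) : ℝ) with hN
  have hN' := card_sample (n := n) (k := k)
  rw [← hN] at hN'
  have hN0 : 0 < N := by
    have := card_bits_pos (ι := Fin n)
    rw [hN']; positivity
  have hs : ∀ s : Sample n k, ∑ t ∈ T, (if g t s.Z = s.S then P s.B t else 0)
      ≤ ∑ t ∈ T, (if g t s.Z = s.S then predLaw P s.Z t else 0) + (c + (∑ t ∈ T, P s.B t *
        (Real.log (P s.B t) - Real.log (predLaw P s.Z t))) / c) := fun s =>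
    (sum_ite_le (h0 _) (predLaw_nonneg h0 _) (h1 _) (sum_predLaw h1 _) hc _).trans <| by
      gcongr; exact hell_le_natCost_term h0 h1 s
  -- Given `(D, M)`, a transcript drawn from `predLaw` is independent of the uniform type.
  have hq : ∑ s : Sample n k, ∑ t ∈ T, (if g t s.Z = s.S then predLaw P s.Z t else 0) = N / 4 := by
    rw [sum_sample]
    have : ∀ (D : Fin n → Fin k) (m : Fin n) (A : Fin n → Bool), ∑ U, ∑ V, ∑ t ∈ T,
        (if g t (Sample.Z (D, m, A, U, V)) = Sample.S (D, m, A, U, V) then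
          predLaw P (Sample.Z (D, m, A, U, V)) t else 0) = 1 := by
      intro D m A
      simp only [sample_S hk he, Sample.Z, Sample.D, Sample.M]
      simp_rw [Finset.sum_comm (t := T)]
      simp only [sum_ite_type, sum_predLaw h1]
    simp only [this, Finset.sum_const, Finset.card_univ, nsmul_eq_mul, hN', Fintype.card_fun,
      Fintype.card_fin, Fintype.card_bool]
    push_cast; ring
  have := Finset.sum_le_sum fun s (_ : s ∈ Finset.univ) => hs s
  rw [Finset.sum_add_distrib, hq, Finset.sum_add_distrib, ← Finset.sum_div, Finset.sum_const,
    Finset.card_univ, nsmul_eq_mul, ← hN] at this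
  rw [success, natCost, ← hN, div_le_iff₀ hN0]
  refine this.trans_eq ?_
  field_simp
  ring

/-- The law of the transcript when coordinate `m` is zero, the sites in `S` have the bit `1` in
coordinate `ℓ`, and all other coordinates are set by their special sites. -/
noncomputable def cubeLaw (P : (Fin k → Fin n → Bool) → τ → ℝ) (D : Fin n → Fin k) (m ℓ : Fin n)
    (S : Finset (Fin k)) (t : τ) : ℝ :=
  (∑ A, P (inp D (Function.update A m false) ℓ S) t) / Fintype.card (Fin n → Bool)

lemma cubeLaw_nonneg (h0 : ∀ x t, 0 ≤ P x t) (D : Fin n → Fin k) (m ℓ : Fin n)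
    (S : Finset (Fin k)) (t : τ) : 0 ≤ cubeLaw P D m ℓ S t :=
  div_nonneg (Finset.sum_nonneg fun _ _ => h0 _ _) (Nat.cast_nonneg _)

lemma sum_cubeLaw (h1 : ∀ x, ∑ t ∈ T, P x t = 1) (D : Fin n → Fin k) (m ℓ : Fin n)
    (S : Finset (Fin k)) : ∑ t ∈ T, cubeLaw P D m ℓ S t = 1 :=
  sum_mean fun _ => h1 _

lemma cubeLaw_eq_prod {q : Fin k → (Fin n → Bool) → τ → ℝ} (hq : ∀ x t, P x t = ∏ i, q i (x i) t)
    (D : Fin n → Fin k) (m ℓ : Fin n) (t : τ) :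
    ∃ f : Fin k → Bool → ℝ, ∀ S, cubeLaw P D m ℓ S t = ∏ i, f i (decide (i ∈ S)) := by
  refine ⟨fun i b => (∑ A : Fin n → Bool, q i (fun j => if j = ℓ then b else
    if i = D j then Function.update A m false j else false) t) / Fintype.card (Fin n → Bool),
    fun S => ?_⟩
  simp only [cubeLaw, hq]
  -- With `D` fixed, site `i` sees only the bits of the coordinates `j` with `D j = i`.
  refine prod_sum_eq_of_blocks D (fun i A => q i (inp D (Function.update A m false) ℓ S i) t) ?_
  intro i A A' h
  refine congrArg (fun x => q i x t) (funext fun j => ?_)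
  simp only [inp]
  split_ifs with h1 h2
  · rfl
  · by_cases hm : j = m
    · simp [hm]
    · simp [Function.update_of_ne hm, h j h2.symm]
  · rfl

/-- For disjoint sets each site contributes the same two factors to both sides, possibly in the
other order. -/
lemma cubeLaw_mul {q : Fin k → (Fin n → Bool) → τ → ℝ} (hq : ∀ x t, P x t = ∏ i, q i (x i) t)
    (D : Fin n → Fin k) (m ℓ : Fin n) (S S' : Finset (Fin k)) (h : Disjoint S S') (t : τ) :
    cubeLaw P D m ℓ S t * cubeLaw P D m ℓ S' t
      = cubeLaw P D m ℓ ∅ t * cubeLaw P D m ℓ (S ∪ S') t := by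
  obtain ⟨f, hf⟩ := cubeLaw_eq_prod hq D m ℓ t
  simp only [hf, ← Finset.prod_mul_distrib]
  refine Finset.prod_congr rfl fun i _ => ?_
  by_cases hi : i ∈ S
  · have := Finset.disjoint_left.1 h hi
    simp [hi, this, mul_comm]
  · by_cases hi' : i ∈ S' <;> simp [hi, hi']

lemma cubeLaw_update (D : Fin n → Fin k) (m ℓ : Fin n) (S : Finset (Fin k)) (i : Fin k) :
    cubeLaw P (Function.update D ℓ i) m ℓ S = cubeLaw P D m ℓ S := by
  have : ∀ A, inp (Function.update D ℓ i) A ℓ S = inp D A ℓ S := by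
    intro A; funext i' j
    simp only [inp]
    split_ifs with h1 h2 h3 h4 <;> simp_all [Function.update_of_ne]
  unfold cubeLaw
  simp only [this]

/-- In the coordinate `ℓ` the bit `1` of site `i` changes the law of the transcript by this. -/
noncomputable def influence (P : (Fin k → Fin n → Bool) → τ → ℝ) (T : Finset τ)
    (D : Fin n → Fin k) (m ℓ : Fin n) (i : Fin k) : ℝ :=
  hell T (cubeLaw P D m ℓ ∅) (cubeLaw P D m ℓ {i})

/-- Coordinate `ℓ` is overwritten, so `D ℓ` is a uniform site independent of the influences. This is
the source of the factor `k` in the theorem. -/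
lemma sum_influence (m ℓ : Fin n) :
    ∑ D : Fin n → Fin k, ∑ i, influence P T D m ℓ i
      = k * ∑ D : Fin n → Fin k, influence P T D m ℓ (D ℓ) := by
  have := sum_sum_update ℓ fun D : Fin n → Fin k => influence P T D m ℓ (D ℓ)
  rw [Fintype.card_fin] at this
  rw [← this]
  simp only [influence, cubeLaw_update, Function.update_self]

/-- The exchange of roles: on the left `m` is special with type `00`, on the right `ℓ` is the
coordinate under study and `m` is merely zero. -/
lemma bitLaw_inp (D : Fin n → Fin k) {m ℓ : Fin n} (h : ℓ ≠ m) (v : Bool) :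
    bitLaw (fun A => P (inp D A m ∅)) ℓ v = cubeLaw P D m ℓ (if v then {D ℓ} else ∅) := by
  funext t
  unfold bitLaw cubeLaw
  congr 1
  refine Finset.sum_congr rfl fun A _ => congrArg (fun x => P x t) ?_
  funext i j
  simp only [inp]
  rcases eq_or_ne j m with rfl | h1
  · simp [h.symm]
  rcases eq_or_ne j ℓ with rfl | h2
  · cases v <;> simp [h1]
  · simp [h1, h2]

/-- Superadditivity is applied to type `00` alone; the other three types contribute nonnegative
divergences. As `predLaw` mixes all four types, an arbitrary reference law is needed there. -/
lemma card_mul_sum_influence_le (h0 : ∀ x t, 0 ≤ P x t) (h1 : ∀ x, ∑ t ∈ T, P x t = 1)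
    (D : Fin n → Fin k) (m : Fin n) :
    Fintype.card (Fin n → Bool) / 4 * ∑ ℓ ∈ Finset.univ.erase m, influence P T D m ℓ (D ℓ)
      ≤ ∑ A : Fin n → Bool, ∑ U, ∑ V, ∑ t ∈ T, P (Sample.B (D, m, A, U, V)) t *
        (Real.log (P (Sample.B (D, m, A, U, V)) t) - Real.log (predLaw P (D, m) t)) := by
  have key := sum_hell_bitLaw_le (T := T) (P := fun A => P (inp D A m ∅)) (fun _ => h0 _)
    (fun _ => h1 _) (Q := predLaw P (D, m)) (predLaw_nonneg h0 _) (sum_predLaw h1 _)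
    (fun t ht A => by
      have := eq_zero_of_predLaw h0 ht (A, false, false)
      rwa [sample_B, typeSites_false] at this)
  have e1 : ∑ ℓ ∈ Finset.univ.erase m, influence P T D m ℓ (D ℓ)
      ≤ ∑ ℓ, hell T (bitLaw (fun A => P (inp D A m ∅)) ℓ false)
        (bitLaw (fun A => P (inp D A m ∅)) ℓ true) := by
    refine le_trans (le_of_eq ?_) (Finset.sum_le_sum_of_subset_of_nonneg
      (Finset.erase_subset m _) fun _ _ _ => hell_nonneg _ _)
    refine Finset.sum_congr rfl fun ℓ hℓ => ?_
    have hne := Finset.ne_of_mem_erase hℓ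
    rw [bitLaw_inp D hne, bitLaw_inp D hne]
    simp [influence]
  refine (mul_le_mul_of_nonneg_left e1 (by positivity)).trans (key.trans ?_)
  refine Finset.sum_le_sum fun A _ => ?_
  have hnn : ∀ U V, 0 ≤ ∑ t ∈ T, P (Sample.B (D, m, A, U, V)) t *
        (Real.log (P (Sample.B (D, m, A, U, V)) t) - Real.log (predLaw P (D, m) t)) :=
    fun U V => (hell_nonneg _ _).trans (hell_le_natCost_term h0 h1 (D, m, A, U, V))
  have e2 : ∑ t ∈ T, P (inp D A m ∅) t *
        (Real.log (P (inp D A m ∅) t) - Real.log (predLaw P (D, m) t))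
      = ∑ t ∈ T, P (Sample.B (D, m, A, false, false)) t *
        (Real.log (P (Sample.B (D, m, A, false, false)) t) - Real.log (predLaw P (D, m) t)) := by
    rw [sample_B, typeSites_false]
  rw [e2]
  exact (Finset.single_le_sum (fun V _ => hnn false V) (Finset.mem_univ false)).trans
    (Finset.single_le_sum (f := fun U => ∑ V, ∑ t ∈ T, P (Sample.B (D, m, A, U, V)) t *
        (Real.log (P (Sample.B (D, m, A, U, V)) t) - Real.log (predLaw P (D, m) t)))
      (fun U _ => Finset.sum_nonneg fun V _ => hnn U V) (Finset.mem_univ false))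

lemma sum_influence_le_natCost (hk : 0 < k) (hn : 0 < n)
    (h0 : ∀ x t, 0 ≤ P x t) (h1 : ∀ x, ∑ t ∈ T, P x t = 1) :
    ∑ D : Fin n → Fin k, ∑ ℓ, ∑ m ∈ Finset.univ.erase ℓ, ∑ i, influence P T D m ℓ i
      ≤ 16 * ((k : ℝ) ^ n * n) * k * natCost P T := by
  set K : ℝ := (Fintype.card (Fin n → Bool) : ℝ) with hK
  have hK0 : 0 < K := card_bits_pos
  have step := Finset.sum_le_sum fun D (_ : D ∈ (Finset.univ : Finset (Fin n → Fin k))) =>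
    Finset.sum_le_sum fun m (_ : m ∈ (Finset.univ : Finset (Fin n))) =>
      card_mul_sum_influence_le h0 h1 D m
  have e : 4 * ((k : ℝ) ^ n * n * K) * natCost P T = ∑ D : Fin n → Fin k, ∑ m : Fin n,
      ∑ A : Fin n → Bool, ∑ U, ∑ V, ∑ t ∈ T, P (Sample.B (D, m, A, U, V)) t *
        (Real.log (P (Sample.B (D, m, A, U, V)) t) - Real.log (predLaw P (D, m) t)) := by
    rw [natCost, sum_sample, ← card_sample, mul_div_cancel₀]
    · rfl
    · rw [card_sample]; positivity
  rw [← e] at step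
  have e2 : ∑ D : Fin n → Fin k, ∑ ℓ, ∑ m ∈ Finset.univ.erase ℓ, ∑ i, influence P T D m ℓ i
      = k * ∑ D : Fin n → Fin k, ∑ m : Fin n, ∑ ℓ ∈ Finset.univ.erase m,
        influence P T D m ℓ (D ℓ) := by
    have comm : ∀ D : Fin n → Fin k, ∑ m : Fin n, ∑ ℓ ∈ Finset.univ.erase m,
        influence P T D m ℓ (D ℓ) = ∑ ℓ, ∑ m ∈ Finset.univ.erase ℓ, influence P T D m ℓ (D ℓ) :=
      fun D => Finset.sum_comm' fun m ℓ => by simp [ne_comm]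
    rw [Finset.sum_congr rfl fun D _ => comm D, Finset.sum_comm,
      Finset.sum_comm (s := (Finset.univ : Finset (Fin n → Fin k))), Finset.mul_sum]
    refine Finset.sum_congr rfl fun ℓ _ => ?_
    rw [Finset.sum_comm, Finset.sum_comm (s := (Finset.univ : Finset (Fin n → Fin k))),
      Finset.mul_sum]
    exact Finset.sum_congr rfl fun m _ => sum_influence m ℓ
  rw [e2]
  simp only [← Finset.mul_sum] at step
  have hkpos : (0 : ℝ) < k := by exact_mod_cast hk
  have step2 : ∑ D : Fin n → Fin k, ∑ m : Fin n, ∑ ℓ ∈ Finset.univ.erase m,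
        influence P T D m ℓ (D ℓ) ≤ 16 * ((k : ℝ) ^ n * n) * natCost P T := by
    -- The constant 16 is 4 from this `K / 4` times 4 for using one type out of four.
    refine le_of_mul_le_mul_left ?_ (by positivity : 0 < K / 4)
    refine step.trans_eq ?_
    ring
  calc _ ≤ k * (16 * ((k : ℝ) ^ n * n) * natCost P T) := by gcongr
    _ = _ := by ring

/-- The predictor's number of correct guesses over the four types, for given `D`, `M` and `A`. -/
noncomputable def hits (P : (Fin k → Fin n → Bool) → τ → ℝ) (T : Finset τ)
    (g : τ → (Fin n → Fin k) × Fin n → Bool × Bool) (D : Fin n → Fin k) (ℓ : Fin n)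
    (A : Fin n → Bool) : ℝ :=
  ∑ U, ∑ V, ∑ t ∈ T, if g t (D, ℓ) = (U, V) then P (inp D A ℓ (typeSites k U V)) t else 0

lemma hits_nonneg (h0 : ∀ x t, 0 ≤ P x t) (g : τ → (Fin n → Fin k) × Fin n → Bool × Bool)
    (D : Fin n → Fin k) (ℓ : Fin n) (A : Fin n → Bool) : 0 ≤ hits P T g D ℓ A :=
  Finset.sum_nonneg fun U _ => Finset.sum_nonneg fun V _ => Finset.sum_nonneg fun t _ => by
    split_ifs
    · exact h0 _ _
    · rfl

lemma hits_le_four (h0 : ∀ x t, 0 ≤ P x t) (h1 : ∀ x, ∑ t ∈ T, P x t = 1)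
    (g : τ → (Fin n → Fin k) × Fin n → Bool × Bool) (D : Fin n → Fin k) (ℓ : Fin n)
    (A : Fin n → Bool) : hits P T g D ℓ A ≤ 4 := by
  have : hits P T g D ℓ A ≤ ∑ _U : Bool, ∑ _V : Bool, (1 : ℝ) := by
    refine Finset.sum_le_sum fun U _ => Finset.sum_le_sum fun V _ => ?_
    rw [← h1 (inp D A ℓ (typeSites k U V))]
    refine Finset.sum_le_sum fun t _ => ?_
    split_ifs
    · rfl
    · exact h0 _ _
  refine this.trans_eq ?_
  norm_num

lemma sum_hits_update_le {q : Fin k → (Fin n → Bool) → τ → ℝ}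
    (hq : ∀ x t, P x t = ∏ i, q i (x i) t)
    (h0 : ∀ x t, 0 ≤ P x t) (h1 : ∀ x, ∑ t ∈ T, P x t = 1)
    (g : τ → (Fin n → Fin k) × Fin n → Bool × Bool) {c : ℝ} (hc : 0 < c)
    (D : Fin n → Fin k) (m ℓ : Fin n) :
    ∑ A, hits P T g D ℓ (Function.update A m false)
      ≤ Fintype.card (Fin n → Bool) * (1 + 4 * c + 16 / c * ∑ i, influence P T D m ℓ i) := by
  have e : ∑ A, hits P T g D ℓ (Function.update A m false) = Fintype.card (Fin n → Bool) *
      ∑ U, ∑ V, ∑ t ∈ T,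
        if g t (D, ℓ) = (U, V) then cubeLaw P D m ℓ (typeSites k U V) t else 0 := by
    simp only [hits, Finset.mul_sum, mul_ite, mul_zero]
    rw [Finset.sum_comm]
    refine Finset.sum_congr rfl fun U _ => ?_
    rw [Finset.sum_comm]
    refine Finset.sum_congr rfl fun V _ => ?_
    rw [Finset.sum_comm]
    refine Finset.sum_congr rfl fun t _ => ?_
    split_ifs
    · have := card_bits_pos (ι := Fin n)
      rw [cubeLaw]; field_simp
    · simp
  rw [e]
  refine mul_le_mul_of_nonneg_left ?_ card_bits_pos.le
  set I := ∑ i, influence P T D m ℓ i with hI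
  have hUV : ∀ U V, ∑ t ∈ T, (if g t (D, ℓ) = (U, V) then cubeLaw P D m ℓ (typeSites k U V) t
      else 0) ≤ ∑ t ∈ T, (if g t (D, ℓ) = (U, V) then cubeLaw P D m ℓ ∅ t else 0)
        + (c + 4 / c * I) := by
    intro U V
    refine (sum_ite_le (cubeLaw_nonneg h0 D m ℓ _) (cubeLaw_nonneg h0 D m ℓ ∅)
      (sum_cubeLaw h1 D m ℓ _) (sum_cubeLaw h1 D m ℓ ∅) hc _).trans ?_
    gcongr
    rw [hell_comm, div_mul_eq_mul_div]
    gcongr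
    exact hell_le_four_mul_sum (R := cubeLaw P D m ℓ) (cubeLaw_nonneg h0 D m ℓ)
      (sum_cubeLaw h1 D m ℓ) (fun S S' h t => cubeLaw_mul hq D m ℓ S S' h t) _
  refine (Finset.sum_le_sum fun U _ => Finset.sum_le_sum fun V _ => hUV U V).trans_eq ?_
  simp only [Finset.sum_add_distrib]
  -- Under a law that ignores the type, exactly one of the four types is guessed; each type adds an
  -- error `c + 4 / c * I`.
  have : ∑ U, ∑ V, ∑ t ∈ T, (if g t (D, ℓ) = (U, V) then cubeLaw P D m ℓ ∅ t else 0) = 1 := by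
    simp_rw [Finset.sum_comm (t := T)]
    simp only [sum_ite_type, sum_cubeLaw h1]
  rw [this]
  simp
  ring

/-- A predictor for transcripts of product form with information cost `o(n / k)` hardly beats
random guessing. -/
theorem success_le_of_product (hk : 0 < k) (hn : 1 < n) (he : Even k)
    {q : Fin k → (Fin n → Bool) → τ → ℝ} (hq : ∀ x t, P x t = ∏ i, q i (x i) t)
    (h0 : ∀ x t, 0 ≤ P x t) (h1 : ∀ x, ∑ t ∈ T, P x t = 1)
    (g : τ → (Fin n → Fin k) × Fin n → Bool × Bool) {c : ℝ} (hc : 0 < c) :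
    success P T g ≤ 1 / 4 + 2 * c + 1 / (c * (n - 1))
      + 64 * k / (c * (n - 1)) * natCost P T := by
  set K : ℝ := (Fintype.card (Fin n → Bool) : ℝ) with hK
  have hK0 : 0 < K := card_bits_pos
  have hn1 : (0 : ℝ) < n - 1 := by
    have : (1 : ℝ) < n := by exact_mod_cast hn
    linarith
  have hkpos : (0 : ℝ) < k := by exact_mod_cast hk
  have hnpos : (0 : ℝ) < n := by linarith
  have hcard : ∀ ℓ : Fin n, ((Finset.univ.erase ℓ).card : ℝ) = n - 1 := by
    intro ℓ
    rw [Finset.card_erase_of_mem (Finset.mem_univ ℓ), Finset.card_univ, Fintype.card_fin,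
      Nat.cast_sub hn.le, Nat.cast_one]
  have e : success P T g * (4 * ((k : ℝ) ^ n * n * K))
      = ∑ D : Fin n → Fin k, ∑ ℓ, ∑ A, hits P T g D ℓ A := by
    rw [success, sum_sample, ← card_sample, div_mul_cancel₀]
    · simp only [hits, sample_S hk he, sample_B]
      rfl
    · rw [card_sample]; positivity
  have step : ∀ (D : Fin n → Fin k) (ℓ : Fin n), ∑ A, hits P T g D ℓ A
      ≤ K * (1 + 8 * c + 4 / (c * (n - 1)))
        + 16 * K / (c * (n - 1)) * ∑ m ∈ Finset.univ.erase ℓ, ∑ i, influence P T D m ℓ i := by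
    intro D ℓ
    have hne : (Finset.univ.erase ℓ).Nonempty := by
      rw [← Finset.card_pos]
      have := hcard ℓ
      exact_mod_cast this ▸ hn1
    refine (sum_le_sum_update_false _ (hits_nonneg h0 g D ℓ) (hits_le_four h0 h1 g D ℓ) hc
      (Finset.univ.erase ℓ) hne).trans ?_
    rw [hcard, ← hK]
    have := Finset.sum_le_sum fun m (_ : m ∈ Finset.univ.erase ℓ) =>
      sum_hits_update_le hq h0 h1 g hc D m ℓ
    rw [← Finset.mul_sum, Finset.sum_add_distrib, Finset.sum_const, nsmul_eq_mul, hcard,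
      ← Finset.mul_sum, ← hK] at this
    refine (add_le_add_left (div_le_div_of_nonneg_right this hn1.le) _).trans_eq ?_
    field_simp
    ring
  have total := Finset.sum_le_sum fun D (_ : D ∈ (Finset.univ : Finset (Fin n → Fin k))) =>
    Finset.sum_le_sum fun ℓ (_ : ℓ ∈ (Finset.univ : Finset (Fin n))) => step D ℓ
  rw [← e] at total
  simp only [Finset.sum_add_distrib, Finset.sum_const, Finset.card_univ, nsmul_eq_mul,
    ← Finset.mul_sum, Fintype.card_fun, Fintype.card_fin] at total
  have hI := sum_influence_le_natCost (P := P) (T := T) hk (by omega) h0 h1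
  have hI' := mul_le_mul_of_nonneg_left hI (by positivity : 0 ≤ 16 * K / (c * (n - 1)))
  have hN0 : 0 < 4 * ((k : ℝ) ^ n * n * K) := by positivity
  refine le_of_mul_le_mul_right ?_ hN0
  refine total.trans ((add_le_add_right hI' _).trans_eq ?_)
  push_cast
  field_simp
  ring

end Finite

end KGuess

namespace KGuess


/-! ### Entropies of random variables with finitely many values -/

section Entropy

variable {Ω α σ : Type*} [MeasurableSpace Ω] {μ : Measure Ω}

/-- Entropies of different variables become sums over one common index set, so that they can be
combined term by term. -/
lemma entropy_eq_sum [DecidableEq α] {X : Ω → α} (I : Finset σ) (w : σ → ℝ) (f : σ → α)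
    (h : ∀ a, μ.real (X ⁻¹' {a}) = ∑ i ∈ I, if f i = a then w i else 0) :
    entropy μ X * Real.log 2 = -∑ i ∈ I, w i * Real.log (μ.real (X ⁻¹' {f i})) := by
  rw [entropy, div_mul_cancel₀ _ (Real.log_pos one_lt_two).ne', tsum_eq_sum (s := I.image f)]
  · have : ∀ a ∈ I.image f, Real.negMulLog (μ.real (X ⁻¹' {a}))
        = ∑ i ∈ I, if f i = a then -(w i * Real.log (μ.real (X ⁻¹' {f i}))) else 0 := by
      intro a _
      have hL : ∀ L, -(μ.real (X ⁻¹' {a}) * L) = ∑ i ∈ I, if f i = a then -(w i * L) else 0 := by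
        intro L
        rw [h a, Finset.sum_mul, ← Finset.sum_neg_distrib]
        refine Finset.sum_congr rfl fun i _ => ?_
        split_ifs <;> simp
      rw [Real.negMulLog, neg_mul, hL]
      refine Finset.sum_congr rfl fun i _ => ?_
      split_ifs with hi
      · rw [hi]
      · rfl
    rw [Finset.sum_congr rfl this, Finset.sum_comm, ← Finset.sum_neg_distrib]
    refine Finset.sum_congr rfl fun i hi => ?_
    rw [Finset.sum_ite_eq, if_pos (Finset.mem_image_of_mem f hi)]
  · intro a ha
    rw [h a, Finset.sum_eq_zero, Real.negMulLog_zero]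
    intro i hi
    rw [if_neg]
    rintro rfl
    exact ha (Finset.mem_image_of_mem f hi)

end Entropy

/-! ### Transcripts of protocols -/

namespace Protocol

section Transcript

variable {k : ℕ} {X : Type w} (P : Protocol.{u, w} k X)

lemma prefix_step (r : P.Pub) (ρ : ∀ i, P.Priv i) (x : Fin k → X) (b : List Bool) :
    b <+: P.step r ρ x b := by
  unfold step
  split
  · exact List.prefix_refl b
  · exact List.prefix_append _ _

lemma prefix_iterate_step (r : P.Pub) (ρ : ∀ i, P.Priv i) (x : Fin k → X) (c : ℕ) :
    ∀ b : List Bool, b <+: (P.step r ρ x)^[c] b := by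
  induction c with
  | zero => exact fun b => List.prefix_refl b
  | succ c ih => exact fun b => (P.prefix_step r ρ x b).trans (ih _)

lemma length_step_le (r : P.Pub) (ρ : ∀ i, P.Priv i) (x : Fin k → X) (b : List Bool) :
    (P.step r ρ x b).length ≤ b.length + 1 := by
  unfold step
  split <;> simp

lemma length_iterate_step_le (r : P.Pub) (ρ : ∀ i, P.Priv i) (x : Fin k → X) (c : ℕ) :
    ∀ b : List Bool, ((P.step r ρ x)^[c] b).length ≤ b.length + c := by
  induction c with
  | zero => exact fun b => le_rfl
  | succ c ih =>
    intro b
    have h1 := ih (P.step r ρ x b)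
    have h2 := P.length_step_le r ρ x b
    rw [Function.iterate_succ_apply]
    omega

/-- The private strings of site `i` that are consistent with the continuation of the blackboard `b`
to the transcript `t` in `c` steps. -/
def consistent (r : P.Pub) : ℕ → List Bool → List Bool → ∀ i, X → Set (P.Priv i)
  | 0, b, t, _, _ => {_ρ | b = t}
  | c + 1, b, t, i, x =>
    match P.next r b with
    | none => {_ρ | b = t}
    -- The board is continued along `t`, so it does not depend on the other sites. The default
    -- `false` is harmless: past the end of `t` the board is too long, and the final condition `b =
    -- t` fails.
    | some j => {ρ | i = j → P.bit i r ρ x b = t.getD b.length false} ∩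
        consistent r c (b ++ [t.getD b.length false]) t i x

lemma iterate_step_eq_iff (hk : 0 < k) (r : P.Pub) (ρ : ∀ i, P.Priv i) (x : Fin k → X)
    (t : List Bool) (c : ℕ) : ∀ b : List Bool,
      (P.step r ρ x)^[c] b = t ↔ ∀ i, ρ i ∈ P.consistent r c b t i (x i) := by
  -- The condition `b = t` is recorded at the sites, so there has to be one.
  have : Nonempty (Fin k) := ⟨⟨0, hk⟩⟩
  induction c with
  | zero => intro b; simp [consistent]
  | succ c ih =>
    intro b
    rw [Function.iterate_succ_apply]
    cases hn : P.next r b with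
    | none =>
      have hs : P.step r ρ x b = b := by simp [step, hn]
      simp only [consistent, hn, hs, Set.mem_ofPred_eq, forall_const]
      rw [Function.iterate_fixed hs]
    | some j =>
      have hs : P.step r ρ x b = b ++ [P.bit j r (ρ j) (x j) b] := by simp [step, hn]
      simp only [consistent, hn, hs, Set.mem_inter_iff, Set.mem_ofPred_eq, forall_and, ← ih]
      constructor
      · intro h
        have hp := P.prefix_iterate_step r ρ x c (b ++ [P.bit j r (ρ j) (x j) b])
        rw [h] at hp
        obtain ⟨u, rfl⟩ := hp
        have e : (b ++ [P.bit j r (ρ j) (x j) b] ++ u).getD b.length false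
            = P.bit j r (ρ j) (x j) b := by simp [List.getD]
        rw [e]
        exact ⟨fun i hi => by subst hi; rfl, h⟩
      · rintro ⟨h1, h2⟩
        rw [h1 j rfl, h2]

lemma measurableSet_step (x : Fin k → X) (b t : List Bool) :
    MeasurableSet {p : P.Pub × ∀ i, P.Priv i | P.step p.1 p.2 x b = t} := by
  have : {p : P.Pub × ∀ i, P.Priv i | P.step p.1 p.2 x b = t}
      = ⋃ o : Option (Fin k), {p | P.next p.1 b = o} ∩
        {p | o.elim b (fun i => b ++ [P.bit i p.1 (p.2 i) (x i) b]) = t} := by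
    ext p
    simp only [Set.mem_ofPred_eq, Set.mem_iUnion, Set.mem_inter_iff]
    constructor
    · intro h
      refine ⟨_, rfl, ?_⟩
      unfold step at h
      cases hn : P.next p.1 b <;> simpa [hn] using h
    · rintro ⟨o, hn, h⟩
      unfold step
      cases o <;> simpa [hn] using h
  rw [this]
  refine MeasurableSet.iUnion fun o => (measurable_fst (P.measurable_next b o)).inter ?_
  cases o with
  | none => exact MeasurableSet.const (b = t)
  | some i =>
    have hm : Measurable fun p : P.Pub × ∀ i, P.Priv i => P.bit i p.1 (p.2 i) (x i) b :=
      (P.measurable_bit i (x i) b).comp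
        (measurable_fst.prodMk ((measurable_pi_apply i).comp measurable_snd))
    exact hm (t := {c : Bool | b ++ [c] = t}) (MeasurableSet.of_discrete)

lemma measurableSet_iterate_step (x : Fin k → X) (c : ℕ) : ∀ t : List Bool,
    MeasurableSet {p : P.Pub × ∀ i, P.Priv i | (P.step p.1 p.2 x)^[c] [] = t} := by
  induction c with
  | zero => exact fun t => MeasurableSet.const ([] = t)
  | succ c ih =>
    intro t
    have : {p : P.Pub × ∀ i, P.Priv i | (P.step p.1 p.2 x)^[c + 1] [] = t}
        = ⋃ b : List Bool, {p | (P.step p.1 p.2 x)^[c] [] = b} ∩ {p | P.step p.1 p.2 x b = t} := by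
      ext p
      simp [Function.iterate_succ_apply']
    rw [this]
    exact MeasurableSet.iUnion fun b => (ih b).inter (P.measurableSet_step x b t)

lemma measurableSet_transcript (r : P.Pub) (x : Fin k → X) (t : List Bool) :
    MeasurableSet {ρ | P.transcript r ρ x = t} :=
  measurable_prodMk_left (P.measurableSet_iterate_step x P.cost t)

/-- The possible transcripts. -/
noncomputable def transcripts : Finset (List Bool) :=
  (List.finite_length_le Bool P.cost).toFinset

lemma transcript_mem (r : P.Pub) (ρ : ∀ i, P.Priv i) (x : Fin k → X) :
    P.transcript r ρ x ∈ P.transcripts := by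
  simpa [transcripts, transcript] using P.length_iterate_step_le r ρ x P.cost []

/-- The probability of the transcript `t` for the public string `r` and the inputs `x`. -/
noncomputable def prob (r : P.Pub) (x : Fin k → X) (t : List Bool) : ℝ :=
  (Measure.pi P.privLaw).real {ρ | P.transcript r ρ x = t}

lemma prob_nonneg (r : P.Pub) (x : Fin k → X) (t : List Bool) : 0 ≤ P.prob r x t :=
  measureReal_nonneg

lemma sum_prob (r : P.Pub) (x : Fin k → X) : ∑ t ∈ P.transcripts, P.prob r x t = 1 := by
  have := sum_measureReal_preimage_singleton (μ := Measure.pi P.privLaw) P.transcripts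
    (f := fun ρ => P.transcript r ρ x) (fun t _ => P.measurableSet_transcript r x t)
  refine this.trans ?_
  have hu : (fun ρ => P.transcript r ρ x) ⁻¹' (P.transcripts : Set (List Bool)) = Set.univ :=
    Set.eq_univ_of_forall fun ρ => P.transcript_mem r ρ x
  rw [hu, probReal_univ]

/-- The rectangle property: the private strings that lead to `t` form a box, and they are
independent. -/
lemma prob_eq_prod (hk : 0 < k) (r : P.Pub) (x : Fin k → X) (t : List Bool) :
    P.prob r x t = ∏ i, (P.privLaw i).real (P.consistent r P.cost [] t i (x i)) := by
  have : {ρ | P.transcript r ρ x = t}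
      = Set.univ.pi fun i => P.consistent r P.cost [] t i (x i) := by
    ext ρ
    simp [transcript, P.iterate_step_eq_iff hk]
  rw [prob, this, measureReal_def, Measure.pi_pi, ENNReal.toReal_prod]
  rfl

lemma measurable_prob (x : Fin k → X) (t : List Bool) : Measurable fun r => P.prob r x t :=
  (measurable_measure_prodMk_left (ν := Measure.pi P.privLaw)
    (P.measurableSet_iterate_step x P.cost t)).ennreal_toReal

end Transcript

/-! ### Success probability and information cost as finite sums -/

section Law

variable {n k : ℕ} (P : Protocol.{u, 0} k (Fin n → Bool))

lemma psi_real_singleton (s : Sample n k) :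
    (psi n k).real {s} = 1 / Fintype.card (Sample n k) := by
  rw [psi, measureReal_def, ProbabilityTheory.uniformOn_univ, Measure.count_singleton]
  simp

instance [NeZero n] [NeZero k] : IsProbabilityMeasure (psi n k) := by
  unfold psi; infer_instance

instance [NeZero n] [NeZero k] : IsProbabilityMeasure P.law := by
  unfold law; infer_instance

lemma law_real [NeZero n] [NeZero k] (r : P.Pub) (E : Sample n k × List Bool → Prop)
    [DecidablePred E] : P.law.real {p | E (p.1, P.transcript r p.2 p.1.B)}
      = ∑ i ∈ Finset.univ ×ˢ P.transcripts,
        if E i then P.prob r i.1.B i.2 / Fintype.card (Sample n k) else 0 := by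
  have e : {p : Sample n k × ∀ i, P.Priv i | E (p.1, P.transcript r p.2 p.1.B)}
      = ⋃ i ∈ (Finset.univ ×ˢ P.transcripts).filter E,
        {i.1} ×ˢ {ρ | P.transcript r ρ i.1.B = i.2} := by
    ext p
    simp only [Set.mem_ofPred_eq, Set.mem_iUnion, Finset.mem_filter, Finset.mem_product,
      Finset.mem_univ, true_and, Set.mem_prod, Set.mem_singleton_iff, exists_prop]
    constructor
    · exact fun h => ⟨(p.1, _), ⟨P.transcript_mem r p.2 p.1.B, h⟩, rfl, rfl⟩
    · rintro ⟨⟨s, t⟩, ⟨_, h⟩, h1, h2⟩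
      simp only at h1 h2
      rw [← h2, ← h1] at h; exact h
  rw [e, measureReal_biUnion_finset, Finset.sum_filter]
  · refine Finset.sum_congr rfl fun i _ => ?_
    rw [law, measureReal_prod_prod, psi_real_singleton, prob]
    split_ifs
    · ring
    · rfl
  · intro i _ i' _ h
    refine Set.disjoint_left.2 ?_
    rintro p ⟨h1, h2⟩ ⟨h1', h2'⟩
    simp only [Set.mem_singleton_iff, Set.mem_ofPred_eq] at h1 h2 h1' h2'
    refine h (Prod.ext (h1.symm.trans h1') ?_)
    rw [← h2, ← h2', ← h1, ← h1']
  · exact fun i _ => (measurableSet_singleton _).prod (P.measurableSet_transcript r _ _)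

lemma sum_ite_Z (z : (Fin n → Fin k) × Fin n) (F : Sample n k → ℝ) :
    ∑ s : Sample n k, (if s.Z = z then F s else 0)
      = ∑ a : (Fin n → Bool) × Bool × Bool, F (z.1, z.2, a) := by
  rw [Fintype.sum_equiv (Equiv.prodAssoc (Fin n → Fin k) (Fin n)
    ((Fin n → Bool) × Bool × Bool)).symm (fun s => if Sample.Z s = z then F s else 0)
    (fun p => if p.1 = z then F (p.1.1, p.1.2, p.2) else 0) (fun s => rfl),
    Fintype.sum_prod_type, Finset.sum_comm]
  simp

/-- All four entropies are expanded over pairs of a sample and a transcript. Several samples give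
the same `(B, Z)`, because the bit `A` at `M` is overwritten; their number occurs with and without
the transcript and cancels, as `prob` depends on the sample only through `B`. -/
lemma condMutualInfo_eq [NeZero n] [NeZero k] (r : P.Pub) :
    condMutualInfo P.law (fun p => p.1.B) (fun p => P.transcript r p.2 p.1.B) (fun p => p.1.Z)
      = natCost (P.prob r) P.transcripts / Real.log 2 := by
  set N : ℝ := (Fintype.card (Sample n k) : ℝ) with hN
  set I : Finset (Sample n k × List Bool) := Finset.univ ×ˢ P.transcripts with hI
  set w : Sample n k × List Bool → ℝ := fun i => P.prob r i.1.B i.2 / N with hw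
  have hN0 : 0 < N := by
    rw [hN]; exact_mod_cast Fintype.card_pos
  have hlaw : ∀ {α : Type} [DecidableEq α] (f : Sample n k × List Bool → α) (a : α),
      P.law.real ((fun p => f (p.1, P.transcript r p.2 p.1.B)) ⁻¹' {a})
        = ∑ i ∈ I, if f i = a then w i else 0 := fun f a =>
    P.law_real r fun i => f i = a
  have hent : ∀ {α : Type} [DecidableEq α] (f : Sample n k × List Bool → α),
      entropy P.law (fun p => f (p.1, P.transcript r p.2 p.1.B)) * Real.log 2
        = -∑ i ∈ I, w i * Real.log (∑ i' ∈ I, if f i' = f i then w i' else 0) := fun f => by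
    rw [entropy_eq_sum I w f (hlaw f)]
    simp only [hlaw]
  have h1 := hent fun i => (i.1.B, i.1.Z)
  have h2 := hent fun i => i.1.Z
  have h3 := hent fun i => (i.1.B, (i.2, i.1.Z))
  have h4 := hent fun i => (i.2, i.1.Z)
  rw [eq_div_iff (Real.log_pos one_lt_two).ne']
  simp only [condMutualInfo, condEntropy, sub_mul]
  simp only at h1 h2 h3 h4
  rw [h1, h2, h3, h4, natCost, ← Finset.sum_product', ← hI, ← hN, Finset.sum_div]
  simp only [neg_sub_neg, ← Finset.sum_sub_distrib]
  refine Finset.sum_congr rfl fun i hi => ?_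
  obtain ⟨s, t⟩ := i
  have ht : t ∈ P.transcripts := (Finset.mem_product.1 hi).2
  rcases (P.prob_nonneg r s.B t).eq_or_lt with h0 | h0
  · simp [hw, ← h0]
  have hsum : ∀ (p : Sample n k → Prop) [DecidablePred p],
      ∑ i ∈ I, (if p i.1 then w i else 0) = (∑ s', if p s' then (1 : ℝ) else 0) / N := by
    intro p _
    rw [hI, Finset.sum_product, Finset.sum_div]
    refine Finset.sum_congr rfl fun s' _ => ?_
    split_ifs
    · exact (Finset.sum_div _ _ _).symm.trans (congrArg (· / N) (P.sum_prob r s'.B))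
    · simp
  have hsumt : ∀ (p : Sample n k → Prop) [DecidablePred p],
      ∑ i ∈ I, (if p i.1 ∧ i.2 = t then w i else 0)
        = (∑ s' : Sample n k, if p s' then P.prob r s'.B t else 0) / N := by
    intro p _
    rw [hI, Finset.sum_product, Finset.sum_div]
    refine Finset.sum_congr rfl fun s' _ => ?_
    split_ifs with h
    · simp [h, hw, ht]
    · simp [h]
  have e1 : ∑ i ∈ I, (if (i.1.B, i.1.Z) = (s.B, s.Z) then w i else 0)
      = (∑ s' : Sample n k, if (s'.B, s'.Z) = (s.B, s.Z) then (1 : ℝ) else 0) / N :=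
    hsum fun s' => (s'.B, s'.Z) = (s.B, s.Z)
  have e2 : ∑ i ∈ I, (if i.1.Z = s.Z then w i else 0)
      = (Fintype.card ((Fin n → Bool) × Bool × Bool) : ℝ) / N := by
    rw [hsum fun s' => s'.Z = s.Z, sum_ite_Z]
    simp
  have e3 : ∑ i ∈ I, (if (i.1.B, (i.2, i.1.Z)) = (s.B, (t, s.Z)) then w i else 0)
      = P.prob r s.B t *
        ((∑ s' : Sample n k, if (s'.B, s'.Z) = (s.B, s.Z) then (1 : ℝ) else 0) / N) := by
    have : ∀ s' : Sample n k, P.prob r s.B t * (if (s'.B, s'.Z) = (s.B, s.Z) then (1 : ℝ) else 0)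
        = if (s'.B, s'.Z) = (s.B, s.Z) then P.prob r s'.B t else 0 := by
      intro s'
      split_ifs with h
      · rw [mul_one, (Prod.mk.inj h).1]
      · simp
    rw [← mul_div_assoc, Finset.mul_sum, Finset.sum_congr rfl fun s' _ => this s',
      ← hsumt fun s' => (s'.B, s'.Z) = (s.B, s.Z)]
    refine Finset.sum_congr rfl fun i _ => if_congr ?_ rfl rfl
    simp only [Prod.mk.injEq]
    tauto
  have e4 : ∑ i ∈ I, (if (i.2, i.1.Z) = (t, s.Z) then w i else 0)
      = predLaw (P.prob r) s.Z t *
        ((Fintype.card ((Fin n → Bool) × Bool × Bool) : ℝ) / N) := by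
    have hc : (Fintype.card ((Fin n → Bool) × Bool × Bool) : ℝ) ≠ 0 := by
      exact_mod_cast Fintype.card_ne_zero
    rw [predLaw, ← sum_ite_Z s.Z fun s' => P.prob r s'.B t, div_mul_div_cancel₀ hc,
      ← hsumt fun s' => s'.Z = s.Z]
    refine Finset.sum_congr rfl fun i _ => if_congr ?_ rfl rfl
    simp only [Prod.mk.injEq]
    tauto
  have hcount : (0 : ℝ) < ∑ s' : Sample n k, if (s'.B, s'.Z) = (s.B, s.Z) then (1 : ℝ) else 0 := by
    refine Finset.sum_pos' (fun _ _ => by split_ifs <;> norm_num) ⟨s, Finset.mem_univ _, ?_⟩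
    simp
  have hcard : (0 : ℝ) < Fintype.card ((Fin n → Bool) × Bool × Bool) := by
    exact_mod_cast Fintype.card_pos
  have hpred : predLaw (P.prob r) s.Z t ≠ 0 := fun h =>
    h0.ne' (eq_zero_of_predLaw (P.prob_nonneg r) h s.2.2)
  simp only [e1, e2, e3, e4]
  rw [Real.log_mul h0.ne' (div_pos hcount hN0).ne', Real.log_mul hpred (div_pos hcard hN0).ne']
  simp only [hw]
  ring

lemma infoCost_eq [NeZero n] [NeZero k] :
    P.infoCost = (∫ r, natCost (P.prob r) P.transcripts ∂P.pubLaw) / Real.log 2 := by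
  rw [← integral_div]
  exact integral_congr_ae (Filter.Eventually.of_forall fun r => P.condMutualInfo_eq r)

end Law

end Protocol

/-! ### A uniform bound on the cost for a fixed public string. -/

section Finite

variable {n k : ℕ} {τ : Type*} {P : (Fin k → Fin n → Bool) → τ → ℝ} {T : Finset τ}

/-- `predLaw` is a mean of `K` laws, one of which is `P s.B`, so the likelihood ratio is at most
`K`. This gives integrability over the public string. -/
lemma natCost_le [NeZero n] [NeZero k] (h0 : ∀ x t, 0 ≤ P x t) (h1 : ∀ x, ∑ t ∈ T, P x t = 1) :
    natCost P T ≤ Real.log (Fintype.card ((Fin n → Bool) × Bool × Bool)) := by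
  set K : ℝ := (Fintype.card ((Fin n → Bool) × Bool × Bool) : ℝ) with hK
  have hK0 : 0 < K := by rw [hK]; exact_mod_cast Fintype.card_pos
  have hN0 : (0 : ℝ) < Fintype.card (Sample n k) := by exact_mod_cast Fintype.card_pos
  rw [natCost, div_le_iff₀ hN0]
  have : ∀ s : Sample n k, ∑ t ∈ T, P s.B t * (Real.log (P s.B t) - Real.log (predLaw P s.Z t))
      ≤ Real.log K := by
    intro s
    rw [← one_mul (Real.log K), ← h1 s.B, Finset.sum_mul]
    refine Finset.sum_le_sum fun t _ => ?_
    rcases (h0 s.B t).eq_or_lt with e | e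
    · simp [← e]
    refine mul_le_mul_of_nonneg_left ?_ e.le
    have hle : P s.B t ≤ K * predLaw P s.Z t := by
      rw [predLaw, mul_div_cancel₀ _ hK0.ne']
      exact Finset.single_le_sum (f := fun a => P (Sample.B (s.Z.1, s.Z.2, a)) t)
        (fun a _ => h0 _ _) (Finset.mem_univ s.2.2)
    have hpos : 0 < predLaw P s.Z t := pos_of_mul_pos_right (e.trans_le hle) hK0.le
    have := Real.log_le_log e hle
    rw [Real.log_mul hK0.ne' hpos.ne'] at this
    linarith
  refine (Finset.sum_le_sum fun s _ => this s).trans_eq ?_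
  rw [Finset.sum_const, Finset.card_univ, nsmul_eq_mul, mul_comm]

end Finite

/-! ### Averaging over the public string. -/

namespace Protocol

variable {n k : ℕ} (P : Protocol.{u, 0} k (Fin n → Bool))

lemma integrable_natCost [NeZero n] [NeZero k] :
    Integrable (fun r => natCost (P.prob r) P.transcripts) P.pubLaw := by
  refine Integrable.of_bound (C := Real.log (Fintype.card ((Fin n → Bool) × Bool × Bool)))
    (Measurable.aestronglyMeasurable ?_) (Filter.Eventually.of_forall fun r => ?_)
  · have hm := P.measurable_prob
    have hp : ∀ z t, Measurable fun r => predLaw (P.prob r) z t := fun z t =>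
      (Finset.measurable_fun_sum _ fun a _ => hm _ _).div_const _
    exact (Finset.measurable_fun_sum _ fun s _ => Finset.measurable_fun_sum _ fun t _ =>
      (hm _ _).mul ((hm _ _).log.sub (hp _ _).log)).div_const _
  · rw [Real.norm_of_nonneg (natCost_nonneg (P.prob_nonneg r) (P.sum_prob r))]
    exact natCost_le (P.prob_nonneg r) (P.sum_prob r)

variable {P}

lemma measurableSet_success {g : P.Pub → List Bool → (Fin n → Fin k) × Fin n → Bool × Bool}
    (hg : ∀ t z, Measurable fun r => g r t z) :
    MeasurableSet {p : P.Pub × Sample n k × ∀ i, P.Priv i |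
      g p.1 (P.transcript p.1 p.2.2 p.2.1.B) p.2.1.Z = p.2.1.S} := by
  have : {p : P.Pub × Sample n k × ∀ i, P.Priv i |
      g p.1 (P.transcript p.1 p.2.2 p.2.1.B) p.2.1.Z = p.2.1.S}
      = ⋃ s : Sample n k, ⋃ t : List Bool, {p | p.2.1 = s} ∩
        ({p | P.transcript p.1 p.2.2 s.B = t} ∩ {p | g p.1 t s.Z = s.S}) := by
    ext p
    simp
  rw [this]
  refine MeasurableSet.iUnion fun s => MeasurableSet.iUnion fun t =>
    ((measurable_fst.comp measurable_snd) (measurableSet_singleton s)).inter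
      (MeasurableSet.inter ?_ ?_)
  · exact (measurable_fst.prodMk (measurable_snd.comp measurable_snd))
      (P.measurableSet_iterate_step s.B P.cost t)
  · exact ((hg t s.Z).comp measurable_fst) (measurableSet_singleton s.S)

lemma law_real_success [NeZero n] [NeZero k]
    (g : P.Pub → List Bool → (Fin n → Fin k) × Fin n → Bool × Bool) (r : P.Pub) :
    P.law.real {p | g r (P.transcript r p.2 p.1.B) p.1.Z = p.1.S}
      = success (P.prob r) P.transcripts (g r) := by
  rw [success, Finset.sum_div]
  refine (P.law_real r fun i => g r i.2 i.1.Z = i.1.S).trans ?_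
  rw [Finset.sum_product]
  refine Finset.sum_congr rfl fun s _ => ?_
  rw [Finset.sum_div]
  refine Finset.sum_congr rfl fun t _ => ?_
  split_ifs <;> simp

/-- Bounds that are affine in the information cost pass from fixed public strings to the mean. -/
lemma successProb_le [NeZero n] [NeZero k]
    {g : P.Pub → List Bool → (Fin n → Fin k) × Fin n → Bool × Bool}
    (hg : ∀ t z, Measurable fun r => g r t z) {a b : ℝ}
    (h : ∀ r, success (P.prob r) P.transcripts (g r)
      ≤ a + b * natCost (P.prob r) P.transcripts) :
    P.successProb g ≤ a + b * (Real.log 2 * P.infoCost) := by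
  have hs := measurableSet_success hg
  have e : P.successProb g = ∫ r, success (P.prob r) P.transcripts (g r) ∂P.pubLaw := by
    rw [successProb, measureReal_def, Measure.prod_apply hs, ← integral_toReal
      (measurable_measure_prodMk_left hs).aemeasurable
      (Filter.Eventually.of_forall fun r => measure_lt_top _ _)]
    exact integral_congr_ae (Filter.Eventually.of_forall fun r => law_real_success g r)
  have hint : Integrable (fun r => success (P.prob r) P.transcripts (g r)) P.pubLaw :=
    (Measure.integrable_measure_prodMk_left hs (measure_ne_top _ _)).congr
      (Filter.Eventually.of_forall fun r => law_real_success g r)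
  rw [e, infoCost_eq, mul_div_cancel₀ _ (Real.log_pos one_lt_two).ne']
  refine (integral_mono hint ((integrable_const a).add (P.integrable_natCost.const_mul b))
    h).trans_eq ?_
  simp only [Pi.add_apply]
  rw [integral_add (integrable_const a) (P.integrable_natCost.const_mul b), integral_const,
    integral_const_mul]
  simp

end Protocol

end KGuess

/-! ### The choice of constants. -/

theorem theorem4p2 (δ : ℝ) (hδ : 0 < δ) :
    ∃ c : ℝ, 0 < c ∧
      ∀ (n k : ℕ), 0 < n → 0 < k → Even k →
      ∀ (P : KGuess.Protocol k (Fin n → Bool))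
        (g : P.Pub → List Bool → (Fin n → Fin k) × Fin n → Bool × Bool),
        (∀ t z, Measurable (fun r => g r t z)) →
        1 / 4 + δ ≤ P.successProb g →
        c * ((n : ℝ) / (k : ℝ)) ≤ P.infoCost := by
  have hL : 0 < Real.log 2 := Real.log_pos one_lt_two
  have hL1 : Real.log 2 ≤ 1 := by linarith [Real.log_two_lt_d9]
  -- Beyond this threshold the error `1 / (c * (n - 1))` with `c = δ / 4` is at most `δ / 4`.
  set B : ℝ := 1 + 16 / δ ^ 2 with hB
  have hB1 : 1 < B := by rw [hB]; linarith [show 0 < 16 / δ ^ 2 by positivity]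
  have hB0 : 0 < B := by linarith
  refine ⟨min (δ ^ 2 / 4 / B) (δ ^ 2 / 2048), by positivity, ?_⟩
  intro n k hn hk he P g hg hs
  have : NeZero n := ⟨hn.ne'⟩
  have : NeZero k := ⟨hk.ne'⟩
  have hk1 : (1 : ℝ) ≤ k := by exact_mod_cast hk
  have hk0 : (0 : ℝ) < k := by linarith
  have hn1 : (1 : ℝ) ≤ n := by exact_mod_cast hn
  have hδ2 : 0 < δ ^ 2 := by positivity
  rcases le_or_gt (n : ℝ) B with hnB | hnB
  · have key := P.successProb_le hg (a := 1 / 4 + δ / 2) (b := 2 / δ) fun r => by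
      have := KGuess.success_le hk hn he (P.prob_nonneg r) (P.sum_prob r) (g r) (half_pos hδ)
      refine this.trans_eq ?_
      field_simp
    have h1 : δ ^ 2 / 4 ≤ P.infoCost := by
      have h2 : δ / 2 ≤ 2 / δ * (Real.log 2 * P.infoCost) := by linarith
      rw [div_mul_eq_mul_div, le_div_iff₀ hδ] at h2
      nlinarith
    have h2 : (n : ℝ) / k ≤ B := (div_le_self (by linarith) hk1).trans hnB
    calc _ ≤ δ ^ 2 / 4 / B * B := by
          gcongr
          exact min_le_left _ _
      _ = δ ^ 2 / 4 := by field_simp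
      _ ≤ _ := h1
  · have hn2 : 1 < n := by exact_mod_cast hB1.trans hnB
    have hnm : 0 < (n : ℝ) - 1 := by linarith
    have key := P.successProb_le hg (a := 1 / 4 + 3 * δ / 4)
        (b := 64 * k / (δ / 4 * (n - 1))) fun r => by
      have := KGuess.success_le_of_product hk hn2 he
        (q := fun i x t => (P.privLaw i).real (P.consistent r P.cost [] t i x))
        (P.prob_eq_prod hk r) (P.prob_nonneg r)
        (P.sum_prob r) (g r) (by positivity : 0 < δ / 4)
      refine this.trans ?_
      have h3 : 1 / (δ / 4 * ((n : ℝ) - 1)) ≤ δ / 4 := by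
        rw [div_le_iff₀ (by positivity)]
        have : 16 / δ ^ 2 ≤ (n : ℝ) - 1 := by rw [hB] at hnB; linarith
        rw [div_le_iff₀ hδ2] at this
        nlinarith
      linarith
    -- The errors that do not involve the cost use up `3 * δ / 4`. What remains yields `δ ^ 2 * (n -
    -- 1) / (1024 * k)`, and `n / 2 ≤ n - 1` gives the constant 2048.
    have h2 : δ / 4 ≤ 64 * k / (δ / 4 * (n - 1)) * (Real.log 2 * P.infoCost) := by linarith
    rw [div_mul_eq_mul_div, le_div_iff₀ (by positivity)] at h2
    have hI : 0 ≤ P.infoCost := by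
      rw [KGuess.Protocol.infoCost_eq]
      exact div_nonneg (MeasureTheory.integral_nonneg fun r =>
        KGuess.natCost_nonneg (P.prob_nonneg r) (P.sum_prob r)) hL.le
    have hn3 : (n : ℝ) / 2 ≤ n - 1 := by
      have : (2 : ℝ) ≤ n := by exact_mod_cast hn2
      linarith
    calc _ ≤ δ ^ 2 / 2048 * ((n : ℝ) / k) := by
          gcongr
          exact min_le_right _ _
      _ ≤ _ := by
          rw [← mul_div_assoc, div_le_iff₀ hk0]
          have h4 : Real.log 2 * P.infoCost ≤ P.infoCost := mul_le_of_le_one_left hI hL1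
          have h5 : δ ^ 2 / 16 * (n / 2) ≤ δ / 4 * (δ / 4 * (n - 1)) := by nlinarith
          have h6 : 64 * k * (Real.log 2 * P.infoCost) ≤ 64 * k * P.infoCost := by gcongr
          linarith
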